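/- **Setting.** Let $N=\Gamma\backslash G$ be a compact quotient of a six-dimensional simply connected nilpotent Lie group $G$ by a discrete subgroup $\Gamma$, and let $\mathfrak g$ be the Lie algebra of $G$. All forms, complex structures, metrics and connections below are invariant, i.e. given on $\mathfrak g$, and $d\alpha(X,Y)=-\alpha([X,Y])$ on 1-forms. Assume that $\mathfrak g$ has a complex coframe $\{\omega^1,\omega^2,\omega^3\}$ with $$d\omega^1=0,\qquad d\omega^2=\omega^{13}+\omega^{1\bar3},\qquad d\omega^3=\pm i(\omega^{1\bar2}-\omega^{2\bar1}),$$ for one choice of the sign (so $\mathfrak g\cong(0,0,0,12,23,14-35)$), and let $J=J_0^{\pm}$ be the complex structure for which the $\omega^j$ are of type $(1,0)$, with the convention $(J\alpha)(X)=-\alpha(JX)$, so that $J\omega^j=i\omega^j$. *Family II* consists of the Hermitian structures $(J,F)$, $F(X,Y)=g(X,JY)$, with $$2F=i(r^2\omega^{1\bar1}+s^2\omega^{2\bar2}+t^2\omega^{3\bar3})+\omega^{2\bar3}-\omega^{3\bar2},\qquad r,s,t\in\mathbb R,\ r\neq0,\ s^2t^2>1.$$ Let $p,q$ be real numbers such that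 $p^2,q^2$ are the two distinct (positive) roots of $t^2X^2-s^2t^2X+\frac{s^2}{4}$, and define the orthonormal coframe $\{e^1,\dots,e^6\}$ (dual basis $\{e_1,\dots,e_6\}$) by $$e^1+ie^2=r\,\omega^1,\quad e^3+ie^4=p\left(\omega^2+\tfrac{i}{2p^2}\omega^3\right),\quad e^5+ie^6=q\left(i\omega^2-\tfrac1{2q^2}\omega^3\right),$$ so that $Je^1=-e^2$, $Je^3=-e^4$, $Je^5=-e^6$, $F=e^{12}+e^{34}+e^{56}$. Put $\Psi=(e^1+ie^2)\wedge(e^3+ie^4)\wedge(e^5+ie^6)$. Let $T=JdF$, i.e. $T(X,Y,Z)=-dF(JX,JY,JZ)$. With $\nabla^g$ the Levi-Civita connection, the Bismut connection $\nabla^+$ and the Chern connection $\nabla^c$ are given by $g(\nabla^+_XY,Z)=g(\nabla^g_XY,Z)+\frac12T(X,Y,Z)$ and $g(\nabla^c_XY,Z)=g(\nabla^g_XY,Z)+\frac12dF(JX,Y,Z)$. For a connection with connection forms $\sigma^i_j$ ($\nabla_Xe_j=\sum_i\sigma^i_j(X)e_i$) let $\Omega^i_j=d\sigma^i_j+\sum_k\sigma^i_k\wedge\sigma^k_j$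 and $p_1=\frac1{8\pi^2}\sum_{i<j}\Omega^i_j\wedge\Omega^i_j$. It is an *SU(3)-connection* if it preserves $F$ and $\Psi$, and an *SU(3)-instanton* if moreover, for all $i,j,k,l$, $$\Omega^i_j(e_1,e_2)+\Omega^i_j(e_3,e_4)+\Omega^i_j(e_5,e_6)=0,\qquad \Omega^i_j(Je_k,Je_l)=\Omega^i_j(e_k,e_l).$$ For $\lambda,\mu,\tau\in\mathbb R$ and $\varphi=\lambda e^1+\mu e^2+\tau e^6$, let $A_{\lambda,\mu,\tau}$ be the connection with $\sigma^2_3=\sigma^2_5=\sigma^4_5=\frac12\sigma^5_6=-\varphi$, $\sigma^i_j=\varphi$ for all other $i<j$, and $\sigma^j_i=-\sigma^i_j$. The *heterotic supersymmetry equations* for $(N,J,F,\Psi,A,\nabla^c)$, dilaton $\phi\in C^\infty(N)$ and $\alpha'>0$, where $(J,F,\Psi)$ is a Hermitian SU(3)-structure with holomorphic $\Psi$, are: the holonomy of $\nabla^+$ is contained in $\mathrm{SU}(3)$; the Lee form $\theta=-\frac12J\delta F$ equals $2d\phi$; $A$ is an SU(3)-instanton; and the anomaly cancellation condition $dT=2\pi^2\alpha'\,(p_1(\nabla^c)-p_1(A))$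 holds. **Theorem 4.4.** For every structure in Family II and all $\lambda,\mu\in\mathbb R$: 1. $A_{\lambda,\mu,\tau}$ is an SU(3)-connection for every $\tau\in\mathbb R$; it is an SU(3)-instanton if and only if $\tau=0$, and $A_{\lambda,\mu,0}$ is flat. 2. There is $\alpha'>0$ with $dT=2\pi^2\alpha'\,(p_1(\nabla^c)-p_1(A_{\lambda,\mu,0}))$ if and only if $s^2=t^2$, and in that case $$dT=4r^2\pi^2\,\bigl(p_1(\nabla^c)-p_1(A_{\lambda,\mu,0})\bigr)=4r^2\pi^2\,p_1(\nabla^c).$$ 3. If $s^2=t^2$ (hence $s^2=t^2>1$), then $T\neq0$, and $(N,J,F,\Psi,A_{\lambda,\mu,0},\nabla^c)$ with any constant dilaton $\phi$ and $\alpha'=2r^2$ is a compact solution of the heterotic supersymmetry equations. -/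

import Mathlib

open scoped Manifold ContDiff
open Complex (I)

namespace Heterotic

section Forms

/-! ## Forms on a real Lie algebra

A left-invariant form on a Lie group is a form on its Lie algebra; a `k`-form is given by its values
on `k` vectors, and the differential is the Chevalley-Eilenberg differential, so that
`dα(X, Y) = -α([X, Y])`. -/

variable {𝔤 : Type*} [LieRing 𝔤] [LieAlgebra ℝ 𝔤] {W : Type*} [AddCommGroup W]

/-- Differential of a 1-form. -/
def d1 (α : 𝔤 → W) : 𝔤 → 𝔤 → W := fun X Y => -α ⁅X, Y⁆

/-- Differential of a 2-form. -/
def d2 (β : 𝔤 → 𝔤 → W) : 𝔤 → 𝔤 → 𝔤 → W := fun X Y Z =>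
  -β ⁅X, Y⁆ Z + β ⁅X, Z⁆ Y - β ⁅Y, Z⁆ X

/-- Differential of a 3-form. -/
def d3 (η : 𝔤 → 𝔤 → 𝔤 → W) : 𝔤 → 𝔤 → 𝔤 → 𝔤 → W := fun X Y Z V =>
  -η ⁅X, Y⁆ Z V + η ⁅X, Z⁆ Y V - η ⁅X, V⁆ Y Z - η ⁅Y, Z⁆ X V + η ⁅Y, V⁆ X Z - η ⁅Z, V⁆ X Y

/-- Wedge product of two 1-forms. -/
def wedge {R : Type*} [CommRing R] (α β : 𝔤 → R) : 𝔤 → 𝔤 → R := fun X Y => α X * β Y - α Y * β X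

/-- Wedge product of two 2-forms (sum over the six (2,2)-shuffles). -/
def wedge22 (α β : 𝔤 → 𝔤 → ℝ) : 𝔤 → 𝔤 → 𝔤 → 𝔤 → ℝ := fun X Y Z V =>
  α X Y * β Z V - α X Z * β Y V + α X V * β Y Z + α Y Z * β X V - α Y V * β X Z + α Z V * β X Y

/-- Wedge product of three complex 1-forms. -/
def wedge111 (α : Fin 3 → 𝔤 → ℂ) : 𝔤 → 𝔤 → 𝔤 → ℂ := fun X Y Z =>
  Matrix.det (Matrix.of fun a b => α a (![X, Y, Z] b))

/-- Complex conjugate of a complex 1-form. -/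
def conjForm (α : 𝔤 → ℂ) : 𝔤 → ℂ := fun X => (starRingEnd ℂ) (α X)

/-- Action of an almost complex structure on 1-forms, `(Jα)(X) = -α(JX)`. -/
def formJ (J : 𝔤 →ₗ[ℝ] 𝔤) (α : 𝔤 → ℝ) : 𝔤 → ℝ := fun X => -α (J X)

/-! ## Hermitian SU(3)-structures -/

/-- The complex 1-forms `e¹ + i e²`, `e³ + i e⁴`, `e⁵ + i e⁶`. -/
noncomputable def complexCoframe (e : Module.Basis (Fin 6) ℝ 𝔤) : Fin 3 → 𝔤 → ℂ :=
  ![fun X => (e.coord 0 X : ℂ) + I * (e.coord 1 X : ℂ),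
    fun X => (e.coord 2 X : ℂ) + I * (e.coord 3 X : ℂ),
    fun X => (e.coord 4 X : ℂ) + I * (e.coord 5 X : ℂ)]

/-- The (3,0)-form `Ψ = (e¹ + i e²) ∧ (e³ + i e⁴) ∧ (e⁵ + i e⁶)`. -/
noncomputable def volumeForm (e : Module.Basis (Fin 6) ℝ 𝔤) : 𝔤 → 𝔤 → 𝔤 → ℂ :=
  wedge111 (complexCoframe e)

/-- `(J, F, Ψ)` is a Hermitian SU(3)-structure with holomorphic `Ψ`, and the coframe dual to `e` is
adapted to it. Here `F(X, Y) = g(X, JY)`; since `F = e¹² + e³⁴ + e⁵⁶`, the Hermitian metric `g` is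
`e¹ ⊗ e¹ + ⋯ + e⁶ ⊗ e⁶`, i.e. `e` is orthonormal. -/
structure IsSU3Structure (J : 𝔤 →ₗ[ℝ] 𝔤) (F : 𝔤 → 𝔤 → ℝ) (Ψ : 𝔤 → 𝔤 → 𝔤 → ℂ)
    (e : Module.Basis (Fin 6) ℝ 𝔤) : Prop where
  sq : ∀ X, J (J X) = -X
  integrable : ∀ X Y, ⁅J X, J Y⁆ = J ⁅J X, Y⁆ + J ⁅X, J Y⁆ + ⁅X, Y⁆
  adapted_one : formJ J (e.coord 0) = -e.coord 1
  adapted_two : formJ J (e.coord 2) = -e.coord 3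
  adapted_three : formJ J (e.coord 4) = -e.coord 5
  fundamental : F = wedge (e.coord 0) (e.coord 1) + wedge (e.coord 2) (e.coord 3)
    + wedge (e.coord 4) (e.coord 5)
  volume : Ψ = volumeForm e
  holomorphic : d3 Ψ = 0

/-- The torsion 3-form `T = J dF`, i.e. `T(X, Y, Z) = -dF(JX, JY, JZ)`. -/
def torsion (J : 𝔤 →ₗ[ℝ] 𝔤) (F : 𝔤 → 𝔤 → ℝ) : 𝔤 → 𝔤 → 𝔤 → ℝ := fun X Y Z =>
  -d2 F (J X) (J Y) (J Z)

/-! ## Invariant linear connections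

An invariant linear connection `∇` is given by its connection 1-forms `σ i j = σⁱⱼ` with respect to
the basis `e`, that is `∇_X eⱼ = ∑ᵢ σⁱⱼ(X) eᵢ`. -/

/-- Invariant linear connections, through their connection 1-forms. -/
abbrev Conn (𝔤 : Type*) [LieRing 𝔤] [LieAlgebra ℝ 𝔤] : Type _ := Fin 6 → Fin 6 → (𝔤 →ₗ[ℝ] ℝ)

/-- `∇_X Y` for left-invariant `X` and `Y`. -/
noncomputable def nabla (e : Module.Basis (Fin 6) ℝ 𝔤) (σ : Conn 𝔤) (X Y : 𝔤) : 𝔤 :=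
  ∑ i, ∑ j, (σ i j X * e.coord j Y) • e i

/-- The curvature 2-forms `Ωⁱⱼ = dσⁱⱼ + ∑ₖ σⁱₖ ∧ σᵏⱼ`. -/
def curvature (σ : Conn 𝔤) (i j : Fin 6) : 𝔤 → 𝔤 → ℝ :=
  d1 (σ i j) + ∑ k, wedge (σ i k) (σ k j)

/-- The 4-form `p₁ = (1 / 8π²) ∑_{i<j} Ωⁱⱼ ∧ Ωⁱⱼ`. -/
noncomputable def p1 (σ : Conn 𝔤) : 𝔤 → 𝔤 → 𝔤 → 𝔤 → ℝ :=
  (1 / (8 * Real.pi ^ 2)) •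
    ∑ i, ∑ j ∈ Finset.Ioi i, wedge22 (curvature σ i j) (curvature σ i j)

/-- The Levi-Civita connection of the metric for which `e` is orthonormal (Koszul formula):
`σⁱⱼ(eₖ) = -½ (g(eᵢ, [eⱼ, eₖ]) - g(eₖ, [eᵢ, eⱼ]) + g(eⱼ, [eₖ, eᵢ]))`. -/
noncomputable def leviCivita (e : Module.Basis (Fin 6) ℝ 𝔤) : Conn 𝔤 := fun i j =>
  e.constr ℝ fun k => -(1 / 2 : ℝ) *
    (e.coord i ⁅e j, e k⁆ - e.coord k ⁅e i, e j⁆ + e.coord j ⁅e k, e i⁆)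

/-- The Bismut connection `∇⁺`: `g(∇⁺_X Y, Z) = g(∇ᵍ_X Y, Z) + ½ T(X, Y, Z)`. -/
noncomputable def bismut (J : 𝔤 →ₗ[ℝ] 𝔤) (F : 𝔤 → 𝔤 → ℝ) (e : Module.Basis (Fin 6) ℝ 𝔤) : Conn 𝔤 :=
  fun i j => leviCivita e i j + e.constr ℝ fun k => (1 / 2 : ℝ) * torsion J F (e k) (e j) (e i)

/-- The Chern connection `∇ᶜ`: `g(∇ᶜ_X Y, Z) = g(∇ᵍ_X Y, Z) + ½ C(X, Y, Z)`, where
`C(X, Y, Z) = dF(JX, Y, Z)`. -/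
noncomputable def chern (J : 𝔤 →ₗ[ℝ] 𝔤) (F : 𝔤 → 𝔤 → ℝ) (e : Module.Basis (Fin 6) ℝ 𝔤) : Conn 𝔤 :=
  fun i j => leviCivita e i j + e.constr ℝ fun k => (1 / 2 : ℝ) * d2 F (J (e k)) (e j) (e i)

/-- The codifferential `(δF)(X) = -∑ᵢ (∇ᵍ_{eᵢ} F)(eᵢ, X)`. -/
noncomputable def codifferential (F : 𝔤 → 𝔤 → ℝ) (e : Module.Basis (Fin 6) ℝ 𝔤) : 𝔤 → ℝ := fun X =>
  -∑ i, (-F (nabla e (leviCivita e) (e i) (e i)) X - F (e i) (nabla e (leviCivita e) (e i) X))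

/-- The Lee form `θ = (1 / (1 - n)) J δF` in complex dimension `n = 3`. -/
noncomputable def leeForm (J : 𝔤 →ₗ[ℝ] 𝔤) (F : 𝔤 → 𝔤 → ℝ) (e : Module.Basis (Fin 6) ℝ 𝔤) : 𝔤 → ℝ :=
  (1 / (1 - 3) : ℝ) • formJ J (codifferential F e)

/-- An SU(3)-connection: it preserves `F` and `Ψ`. -/
def IsSU3Connection (F : 𝔤 → 𝔤 → ℝ) (Ψ : 𝔤 → 𝔤 → 𝔤 → ℂ) (e : Module.Basis (Fin 6) ℝ 𝔤)
    (σ : Conn 𝔤) : Prop :=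
  (∀ X Y Z, F (nabla e σ X Y) Z + F Y (nabla e σ X Z) = 0) ∧
  (∀ X Y Z V, Ψ (nabla e σ X Y) Z V + Ψ Y (nabla e σ X Z) V + Ψ Y Z (nabla e σ X V) = 0)

/-- An SU(3)-instanton: an SU(3)-connection whose curvature 2-forms are of type (1,1) and
primitive. -/
def IsSU3Instanton (J : 𝔤 →ₗ[ℝ] 𝔤) (F : 𝔤 → 𝔤 → ℝ) (Ψ : 𝔤 → 𝔤 → 𝔤 → ℂ)
    (e : Module.Basis (Fin 6) ℝ 𝔤) (σ : Conn 𝔤) : Prop :=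
  IsSU3Connection F Ψ e σ ∧
  (∀ i j, curvature σ i j (e 0) (e 1) + curvature σ i j (e 2) (e 3)
    + curvature σ i j (e 4) (e 5) = 0) ∧
  (∀ i j k l, curvature σ i j (J (e k)) (J (e l)) = curvature σ i j (e k) (e l))

/-- Flat connections. -/
def IsFlat (σ : Conn 𝔤) : Prop := ∀ i j, curvature σ i j = 0

/-- The anomaly cancellation condition `dT = 2π²α'(p₁(∇) - p₁(A))`, `α' > 0`. -/
def AnomalyCancellation (J : 𝔤 →ₗ[ℝ] 𝔤) (F : 𝔤 → 𝔤 → ℝ) (σ A : Conn 𝔤) (α' : ℝ) : Prop :=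
  0 < α' ∧ d3 (torsion J F) = (2 * Real.pi ^ 2 * α') • (p1 σ - p1 A)

/-- The coefficients of the connection `A_{λ,μ,τ}`. -/
def instantonMatrix : Matrix (Fin 6) (Fin 6) ℝ :=
  !![ 0,  1,  1,  1,  1,  1;
     -1,  0, -1,  1, -1,  1;
     -1,  1,  0,  1,  1,  1;
     -1, -1, -1,  0, -1,  1;
     -1,  1, -1,  1,  0, -2;
     -1, -1, -1, -1,  2,  0]

/-- The connection `A_{λ,μ,τ}`: with `φ = λ e¹ + μ e² + τ e⁶`, one has
`σ²₃ = σ²₅ = σ⁴₅ = ½ σ⁵₆ = -φ`, `σⁱⱼ = φ` for the other `i < j`, and `σʲᵢ = -σⁱⱼ`. -/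
noncomputable def instantonConn (e : Module.Basis (Fin 6) ℝ 𝔤) (l m τ : ℝ) : Conn 𝔤 := fun i j =>
  instantonMatrix i j • (l • e.coord 0 + m • e.coord 1 + τ • e.coord 5)

/-! ## Family II -/

/-- The components of a complex coframe. -/
noncomputable def coform (w : 𝔤 ≃ₗ[ℝ] (Fin 3 → ℂ)) (j : Fin 3) : 𝔤 → ℂ := fun X => w X j

/-- The structure equations `dω¹ = 0`, `dω² = ω¹³ + ω^{1\bar 3}`,
`dω³ = ε i (ω^{1\bar 2} - ω^{2\bar 1})`. -/
structure StructureEquations (ε : ℝ) (w : 𝔤 ≃ₗ[ℝ] (Fin 3 → ℂ)) : Prop where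
  d_one : d1 (coform w 0) = 0
  d_two : d1 (coform w 1) =
    wedge (coform w 0) (coform w 2) + wedge (coform w 0) (conjForm (coform w 2))
  d_three : d1 (coform w 2) = ((ε : ℂ) * I) •
    (wedge (coform w 0) (conjForm (coform w 1)) - wedge (coform w 1) (conjForm (coform w 0)))

/-- The almost complex structure for which `ω¹, ω², ω³` are of type (1,0), i.e. `Jωʲ = i ωʲ`
with the convention `(Jα)(X) = -α(JX)`. -/
noncomputable def complexStructure (w : 𝔤 ≃ₗ[ℝ] (Fin 3 → ℂ)) : 𝔤 →ₗ[ℝ] 𝔤 :=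
  w.symm.toLinearMap ∘ₗ ((-I) • (LinearMap.id : (Fin 3 → ℂ) →ₗ[ℝ] (Fin 3 → ℂ))) ∘ₗ w.toLinearMap

theorem coform_complexStructure (w : 𝔤 ≃ₗ[ℝ] (Fin 3 → ℂ)) (j : Fin 3) (X : 𝔤) :
    -coform w j (complexStructure w X) = I * coform w j X := by
  simp [coform, complexStructure]

/-- `2F = i (r² ω^{1\bar 1} + s² ω^{2\bar 2} + t² ω^{3\bar 3}) + ω^{2\bar 3} - ω^{3\bar 2}`. -/
noncomputable def twiceFamilyII (w : 𝔤 ≃ₗ[ℝ] (Fin 3 → ℂ)) (r s t : ℝ) : 𝔤 → 𝔤 → ℂ :=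
  I • ((r : ℂ) ^ 2 • wedge (coform w 0) (conjForm (coform w 0))
      + (s : ℂ) ^ 2 • wedge (coform w 1) (conjForm (coform w 1))
      + (t : ℂ) ^ 2 • wedge (coform w 2) (conjForm (coform w 2)))
    + wedge (coform w 1) (conjForm (coform w 2)) - wedge (coform w 2) (conjForm (coform w 1))

/-- The fundamental form `F` of Family II; taking the real part loses nothing, as
`two_mul_familyII` shows. -/
noncomputable def familyII (w : 𝔤 ≃ₗ[ℝ] (Fin 3 → ℂ)) (r s t : ℝ) : 𝔤 → 𝔤 → ℝ := fun X Y =>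
  (twiceFamilyII w r s t X Y).re / 2

theorem two_mul_familyII (w : 𝔤 ≃ₗ[ℝ] (Fin 3 → ℂ)) (r s t : ℝ) (X Y : 𝔤) :
    2 * (familyII w r s t X Y : ℂ) = twiceFamilyII w r s t X Y := by
  apply Complex.ext
  · simp only [familyII]
    rw [← Complex.ofReal_ofNat, ← Complex.ofReal_mul, Complex.ofReal_re]
    ring
  · simp [familyII, twiceFamilyII, wedge, conjForm, pow_two]
    ring

/-- The coframe dual to `e` is `e¹ + i e² = r σ¹`, `e³ + i e⁴ = p σ²`, `e⁵ + i e⁶ = q σ³`, where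
`σ¹ = ω¹`, `σ² = ω² + (i / 2p²) ω³`, `σ³ = i ω² - (1 / 2q²) ω³`. -/
structure IsFamilyIIBasis (w : 𝔤 ≃ₗ[ℝ] (Fin 3 → ℂ)) (r p q : ℝ) (e : Module.Basis (Fin 6) ℝ 𝔤) :
    Prop where
  one : complexCoframe e 0 = (r : ℂ) • coform w 0
  two : complexCoframe e 1 = (p : ℂ) • (coform w 1 + (I / (2 * (p : ℂ) ^ 2)) • coform w 2)
  three : complexCoframe e 2 = (q : ℂ) • (I • coform w 1 - (1 / (2 * (q : ℂ) ^ 2)) • coform w 2)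

end Forms

section Nilmanifold

/-! ## Nilmanifolds and the heterotic system -/

instance : ENat.LEInfty (minSmoothness ℝ 3) := ⟨by
  rw [minSmoothness_of_isRCLikeNormedField]
  exact ENat.LEInfty.out⟩

/-- The model space of six-dimensional manifolds. -/
abbrev E6 : Type := EuclideanSpace ℝ (Fin 6)

variable {G : Type*} [TopologicalSpace G] [ChartedSpace E6 G] [Group G]

/-- `N = Γ \ G` is a nilmanifold: `G` is simply connected nilpotent, `Γ` is discrete, and the
quotient of `G` by the left translations by elements of `Γ` is compact. -/
structure IsNilmanifold (Γ : Subgroup G) : Prop where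
  nilpotent : Group.IsNilpotent G
  simplyConnected : SimplyConnectedSpace G
  discrete : DiscreteTopology Γ
  compact : CompactSpace (Quotient (QuotientGroup.rightRel Γ))

variable [LieGroup 𝓘(ℝ, E6) ∞ G]

/-- Parallel transport of an invariant connection around the loops of `N = Γ \ G`, as matrices in
the frame of left-invariant vector fields `e`, which descends to `N`. A `C¹` loop in `N` lifts to a
path `c` in `G` with `c(1) ∈ Γ c(0)`; the vector `v(t)` is its velocity, read in the Lie algebra by
left translation, and the columns of `U` are parallel along `c`: `U' + σ(v) U = 0`, `U(0) = 1`. -/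
def holonomy (Γ : Subgroup G) (σ : Conn (GroupLieAlgebra 𝓘(ℝ, E6) G)) :
    Set (Matrix (Fin 6) (Fin 6) ℝ) :=
  {P | ∃ (c : ℝ → G) (v : ℝ → GroupLieAlgebra 𝓘(ℝ, E6) G) (U : ℝ → Matrix (Fin 6) (Fin 6) ℝ),
    ContMDiff 𝓘(ℝ, ℝ) 𝓘(ℝ, E6) 1 c ∧
    (∃ γ ∈ Γ, c 1 = γ * c 0) ∧
    (∀ t, mfderiv 𝓘(ℝ, ℝ) 𝓘(ℝ, E6) c t (1 : ℝ) = mulInvariantVectorField (v t) (c t)) ∧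
    U 0 = 1 ∧
    (∀ t i j, HasDerivAt (fun x => U x i j) (-∑ k, σ i k (v t) * U t k j) t) ∧
    P = U 1}

/-- The coordinates `x₁ + i x₂`, `x₃ + i x₄`, `x₅ + i x₆`: the index of the complex coordinate, and
`0` for the real part, `1` for the imaginary part. -/
def splitIndex : Fin 6 → Fin 3 × Fin 2 := ![(0, 0), (0, 1), (1, 0), (1, 1), (2, 0), (2, 1)]

/-- The real 6 × 6 matrix of a complex 3 × 3 matrix, for the identification of `ℝ⁶` with `ℂ³`
through the coordinates `x₁ + i x₂`, `x₃ + i x₄`, `x₅ + i x₆`. -/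
def realify (Z : Matrix (Fin 3) (Fin 3) ℂ) : Matrix (Fin 6) (Fin 6) ℝ :=
  (Matrix.of fun x y : Fin 3 × Fin 2 =>
    !![(Z x.1 y.1).re, -(Z x.1 y.1).im; (Z x.1 y.1).im, (Z x.1 y.1).re] x.2 y.2).submatrix
      splitIndex splitIndex

/-- The group SU(3) acting on `ℝ⁶`. -/
def SU3 : Set (Matrix (Fin 6) (Fin 6) ℝ) :=
  realify '' {Z | Z ∈ Matrix.specialUnitaryGroup (Fin 3) ℂ}

/-- `dφ` at `g`, applied to the left-invariant vector field `X`. -/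
noncomputable def leftDeriv (φ : G → ℝ) (g : G) (X : GroupLieAlgebra 𝓘(ℝ, E6) G) : ℝ :=
  mfderiv 𝓘(ℝ, E6) 𝓘(ℝ, ℝ) φ g (mulInvariantVectorField X g)

/-- `(Γ \ G, J, F, Ψ, A, ∇ᶜ)`, with dilaton `φ` (a smooth function on `Γ \ G`) and constant `α'`, is
a compact solution of the heterotic supersymmetry equations with respect to the Chern connection in
the anomaly cancellation condition. -/
structure IsHeteroticSolution (Γ : Subgroup G)
    (J : GroupLieAlgebra 𝓘(ℝ, E6) G →ₗ[ℝ] GroupLieAlgebra 𝓘(ℝ, E6) G)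
    (F : GroupLieAlgebra 𝓘(ℝ, E6) G → GroupLieAlgebra 𝓘(ℝ, E6) G → ℝ)
    (Ψ : GroupLieAlgebra 𝓘(ℝ, E6) G → GroupLieAlgebra 𝓘(ℝ, E6) G →
      GroupLieAlgebra 𝓘(ℝ, E6) G → ℂ)
    (e : Module.Basis (Fin 6) ℝ (GroupLieAlgebra 𝓘(ℝ, E6) G))
    (A : Conn (GroupLieAlgebra 𝓘(ℝ, E6) G)) (φ : G → ℝ) (α' : ℝ) : Prop where
  nilmanifold : IsNilmanifold Γ
  structureSU3 : IsSU3Structure J F Ψ e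
  /-- The holonomy of the Bismut connection is contained in SU(3). -/
  gravitino : holonomy Γ (bismut J F e) ⊆ SU3
  dilaton_smooth : ContMDiff 𝓘(ℝ, E6) 𝓘(ℝ, ℝ) ∞ φ
  dilaton_invariant : ∀ γ ∈ Γ, ∀ g, φ (γ * g) = φ g
  /-- `θ = 2dφ`. -/
  dilatino : ∀ g X, leeForm J F e X = 2 * leftDeriv φ g X
  gaugino : IsSU3Instanton J F Ψ e A
  anomaly : AnomalyCancellation J F (chern J F e) A α'

end Nilmanifold

end Heterotic

open Heterotic

/-! In the orthonormal coframe every quantity is polynomial in `p`, `q` and two constants `b`, `g`,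
the scales of `dω²` and `dω³`: `b = 4pq / (r(p² - q²))` and `g = ε / (pqr(p² - q²))`.
`IsFamilyIIAlgebra` records these real structure equations, and the geometry is computed from them
alone.

Indices of the coframe run from 0 to 5. Both `dT` and `p₁(∇ᶜ)` lie in the span of `e⁰¹²³`, `e⁰¹⁴⁵`
and `e⁰¹²⁴ + e⁰¹³⁵`. In `p₁(∇ᶜ)` the first two coefficients are equal; in `dT` they differ by a
nonzero multiple of `(p² - q²)(g² - b²)`. Since `A` is flat at `τ = 0`, the anomaly condition says
that `dT` is proportional to `p₁(∇ᶜ)`, which forces `g² = b²`. That equality means `4p²q² = 1`, and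
by Vieta `t² · 4p²q² = s²`, so it is the condition `s² = t²`. The ratio is then `16π² / (b²(p² -
q²)²) = 4r²π²` (`d3_torsion`, `p1_chern`, `sq_eq_sq_of_d3_torsion_eq`, `d3_torsion_eq_smul_p1`).

All forms of `A` are multiples of one form `φ`, so its curvature is a constant matrix times `dφ = τ
de⁵`, and `de⁵` is not of type (1,1). The Lee form vanishes, so constant dilatons suffice. The
Bismut connection has `𝔰𝔲(3)`-valued forms, and conserved quantities of the parallel transport
equation put its holonomy in SU(3). -/

namespace Heterotic

/-! ### Connections with values in 𝔲(3) and 𝔰𝔲(3) -/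

section SpecialUnitary

variable {𝔤 : Type*} [LieRing 𝔤] [LieAlgebra ℝ 𝔤]

/-- The connection forms take values in `𝔲(3) ⊆ 𝔰𝔬(6)`, for the complex coordinates
`x₀ + i x₁`, `x₂ + i x₃`, `x₄ + i x₅`. -/
structure IsU3Valued (σ : Conn 𝔤) : Prop where
  skew : ∀ i j X, σ j i X = -σ i j X
  re01 : ∀ X, σ 1 3 X = σ 0 2 X
  im01 : ∀ X, σ 1 2 X = -σ 0 3 X
  re02 : ∀ X, σ 1 5 X = σ 0 4 X
  im02 : ∀ X, σ 1 4 X = -σ 0 5 X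
  re12 : ∀ X, σ 3 5 X = σ 2 4 X
  im12 : ∀ X, σ 3 4 X = -σ 2 5 X

/-- The connection forms take values in `𝔰𝔲(3) ⊆ 𝔰𝔬(6)`. -/
structure IsSu3Valued (σ : Conn 𝔤) : Prop extends IsU3Valued σ where
  trace : ∀ X, σ 4 5 X = -σ 0 1 X - σ 2 3 X

theorem coord_basis (e : Module.Basis (Fin 6) ℝ 𝔤) (i j : Fin 6) :
    e.coord i (e j) = if j = i then 1 else 0 := by
  simp [Finsupp.single_apply]

theorem coord_nabla (e : Module.Basis (Fin 6) ℝ 𝔤) (σ : Conn 𝔤) (X Y : 𝔤) (i : Fin 6) :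
    e.coord i (nabla e σ X Y) = ∑ j, σ i j X * e.coord j Y := by
  simp [nabla, Finsupp.single_apply]

/-- The complex coordinates of a vector of `ℝ⁶`. -/
noncomputable def complexVec (u : Fin 6 → ℝ) : Fin 3 → ℂ :=
  ![u 0 + I * u 1, u 2 + I * u 3, u 4 + I * u 5]

/-- The complex 3 × 3 matrix of an `𝔰𝔲(3)`-valued connection at a vector. -/
noncomputable def complexEntry (σ : Conn 𝔤) (X : 𝔤) : Matrix (Fin 3) (Fin 3) ℂ :=
  !![-I * (σ 0 1 X : ℂ), σ 0 2 X - I * σ 0 3 X, σ 0 4 X - I * σ 0 5 X;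
     -(σ 0 2 X : ℂ) - I * σ 0 3 X, -I * (σ 2 3 X : ℂ), σ 2 4 X - I * σ 2 5 X;
     -(σ 0 4 X : ℂ) - I * σ 0 5 X, -(σ 2 4 X : ℂ) - I * σ 2 5 X, I * (σ 0 1 X + σ 2 3 X : ℂ)]

theorem complexEntry_skew (σ : Conn 𝔤) (X : 𝔤) (a b : Fin 3) :
    (starRingEnd ℂ) (complexEntry σ X a b) = -complexEntry σ X b a := by
  fin_cases a <;> fin_cases b <;> simp [complexEntry] <;> ring

theorem complexEntry_trace (σ : Conn 𝔤) (X : 𝔤) :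
    complexEntry σ X 0 0 + complexEntry σ X 1 1 + complexEntry σ X 2 2 = 0 := by
  simp [complexEntry]; ring

theorem IsU3Valued.diag {σ : Conn 𝔤} (hσ : IsU3Valued σ) (i : Fin 6) (X : 𝔤) : σ i i X = 0 := by
  linarith [hσ.skew i i X]

namespace IsSu3Valued

variable {σ : Conn 𝔤}

/-- The relations in `IsU3Valued` say that the real 6 × 6 matrix commutes with multiplication by
`i`, so it acts on `ℂ³` by a complex matrix. -/
theorem complexVec_apply (hσ : IsSu3Valued σ) (X : 𝔤) (u : Fin 6 → ℝ) (a : Fin 3) :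
    complexVec (fun i => ∑ j, σ i j X * u j) a = ∑ b, complexEntry σ X a b * complexVec u b := by
  have hI : I * I = -1 := Complex.I_mul_I
  have hd := fun i => hσ.diag i X
  fin_cases a <;>
    simp [complexVec, complexEntry, Fin.sum_univ_six, Fin.sum_univ_three, hd,
      hσ.skew 0 1 X, hσ.skew 0 2 X, hσ.skew 0 3 X, hσ.skew 0 4 X, hσ.skew 0 5 X, hσ.skew 1 2 X,
      hσ.skew 1 3 X, hσ.skew 1 4 X, hσ.skew 1 5 X, hσ.skew 2 3 X, hσ.skew 2 4 X, hσ.skew 2 5 X,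
      hσ.skew 3 4 X, hσ.skew 3 5 X, hσ.skew 4 5 X, hσ.re01 X, hσ.im01 X, hσ.re02 X, hσ.im02 X,
      hσ.re12 X, hσ.im12 X, hσ.trace X] <;>
    (ring_nf; simp only [Complex.I_sq]; ring)

/-- `F` is preserved because the matrix is skew and complex linear; on `Ψ`, a complex determinant,
the matrix acts by its complex trace, which is zero. -/
theorem isSU3Connection (hσ : IsSu3Valued σ) (e : Module.Basis (Fin 6) ℝ 𝔤) :
    IsSU3Connection (wedge (e.coord 0) (e.coord 1) + wedge (e.coord 2) (e.coord 3)
      + wedge (e.coord 4) (e.coord 5)) (volumeForm e) e σ := by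
  constructor
  · intro X Y Z
    have hd := fun i => hσ.diag i X
    simp only [Pi.add_apply, wedge, coord_nabla, Fin.sum_univ_six, hd,
      hσ.skew 0 1 X, hσ.skew 0 2 X, hσ.skew 0 3 X, hσ.skew 0 4 X, hσ.skew 0 5 X, hσ.skew 1 2 X,
      hσ.skew 1 3 X, hσ.skew 1 4 X, hσ.skew 1 5 X, hσ.skew 2 3 X, hσ.skew 2 4 X, hσ.skew 2 5 X,
      hσ.skew 3 4 X, hσ.skew 3 5 X, hσ.skew 4 5 X, hσ.re01 X, hσ.im01 X, hσ.re02 X, hσ.im02 X,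
      hσ.re12 X, hσ.im12 X, hσ.trace X]
    ring
  · intro X Y Z V
    have hE : ∀ Y a, complexCoframe e a Y = complexVec (fun i => e.coord i Y) a := by
      intro Y a
      fin_cases a <;> rfl
    have hn : ∀ Y a, complexCoframe e a (nabla e σ X Y) =
        ∑ b, complexEntry σ X a b * complexCoframe e b Y := by
      intro Y a
      simp only [hE, coord_nabla]
      exact hσ.complexVec_apply X _ a
    simp only [volumeForm, wedge111, Matrix.det_fin_three, Matrix.of_apply, Matrix.cons_val_zero,
      Matrix.cons_val_one, Matrix.cons_val, hn, Fin.sum_univ_three]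
    have ht : complexEntry σ X 2 2 = -complexEntry σ X 0 0 - complexEntry σ X 1 1 := by
      linear_combination complexEntry_trace σ X
    rw [ht]
    ring

end IsSu3Valued

/-! ### Conserved quantities of parallel transport -/

section ParallelTransport

variable {ζ : ℝ → Matrix (Fin 3) (Fin 3) ℂ}

/-- Solutions of a linear equation with skew-Hermitian coefficients have constant Hermitian
products. -/
theorem star_dotProduct_const (hζ : ∀ t a b, (starRingEnd ℂ) (ζ t a b) = -ζ t b a)
    {u v : ℝ → Fin 3 → ℂ}
    (hu : ∀ t a, HasDerivAt (fun x => u x a) (-∑ b, ζ t a b * u t b) t)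
    (hv : ∀ t a, HasDerivAt (fun x => v x a) (-∑ b, ζ t a b * v t b) t) (t : ℝ) :
    ∑ a, (starRingEnd ℂ) (u t a) * v t a = ∑ a, (starRingEnd ℂ) (u 0 a) * v 0 a := by
  have h : ∀ t, HasDerivAt (fun x => ∑ a, (starRingEnd ℂ) (u x a) * v x a) 0 t := by
    intro t
    have h1 := HasDerivAt.fun_sum (u := Finset.univ) fun a _ => ((hu t a).star).mul (hv t a)
    refine h1.congr_deriv ?_
    simp only [Fin.sum_univ_three, ← starRingEnd_apply, map_neg, map_add, map_mul, hζ]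
    ring
  exact is_const_of_deriv_eq_zero (fun t => (h t).differentiableAt) (fun t => (h t).deriv) t 0

/-- Liouville's formula: the logarithmic derivative of the determinant is `-tr ζ`, which vanishes.
-/
theorem det_const (hζ : ∀ t, ζ t 0 0 + ζ t 1 1 + ζ t 2 2 = 0)
    {Z : ℝ → Matrix (Fin 3) (Fin 3) ℂ}
    (hZ : ∀ t a b, HasDerivAt (fun x => Z x a b) (-∑ c, ζ t a c * Z t c b) t) (t : ℝ) :
    (Z t).det = (Z 0).det := by
  have h : ∀ t, HasDerivAt (fun x => (Z x).det) 0 t := by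
    intro t
    simp only [Matrix.det_fin_three]
    have h1 := (((((((hZ t 0 0).mul (hZ t 1 1)).mul (hZ t 2 2)).sub
      (((hZ t 0 0).mul (hZ t 1 2)).mul (hZ t 2 1))).sub
      (((hZ t 0 1).mul (hZ t 1 0)).mul (hZ t 2 2))).add
      (((hZ t 0 1).mul (hZ t 1 2)).mul (hZ t 2 0))).add
      (((hZ t 0 2).mul (hZ t 1 0)).mul (hZ t 2 1))).sub
      (((hZ t 0 2).mul (hZ t 1 1)).mul (hZ t 2 0))
    refine h1.congr_deriv ?_
    have ht : ζ t 2 2 = -ζ t 0 0 - ζ t 1 1 := by linear_combination hζ t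
    simp only [Fin.sum_univ_three, ht, Pi.mul_apply]
    ring
  exact is_const_of_deriv_eq_zero (fun t => (h t).differentiableAt) (fun t => (h t).deriv) t 0

end ParallelTransport

end SpecialUnitary

/-! ### From 𝔰𝔲(3)-valued forms to holonomy in SU(3) -/

section Holonomy

variable {G : Type*} [TopologicalSpace G] [ChartedSpace E6 G] [Group G]
  [LieGroup 𝓘(ℝ, E6) ∞ G]

theorem IsSu3Valued.holonomy_subset {σ : Conn (GroupLieAlgebra 𝓘(ℝ, E6) G)} (hσ : IsSu3Valued σ)
    (Γ : Subgroup G) : holonomy Γ σ ⊆ SU3 := by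
  rintro P ⟨c, v, U, -, -, -, hU0, hU, rfl⟩
  set ζ : ℝ → Matrix (Fin 3) (Fin 3) ℂ := fun t => complexEntry σ (v t) with hζ
  set W : Fin 6 → ℝ → Fin 3 → ℂ := fun j t => complexVec fun i => U t i j with hW
  have hdW : ∀ j t a, HasDerivAt (fun x => W j x a) (-∑ b, ζ t a b * W j t b) t := by
    intro j t a
    have h := hσ.complexVec_apply (v t) (fun i => U t i j) a
    have hc := fun i => (hU t i j).ofReal_comp
    simp only [hζ, hW]
    rw [← h]
    have hadd := fun i k => (hc i).add ((hc k).const_mul I)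
    fin_cases a
    · refine (hadd 0 1).congr_deriv ?_
      simp [complexVec]; ring
    · refine (hadd 2 3).congr_deriv ?_
      simp [complexVec]; ring
    · refine (hadd 4 5).congr_deriv ?_
      simp [complexVec]; ring
  have hskew : ∀ t a b, (starRingEnd ℂ) (ζ t a b) = -ζ t b a := fun t =>
    complexEntry_skew σ (v t)
  -- Uniqueness for the linear equation without an ODE theorem: `W i - I * W j` solves the same
  -- complex linear equation, so its Hermitian norm is constant; it is zero at time 0, hence always.
  have hJ : ∀ i j, W i 0 = (fun a => I * W j 0 a) → ∀ t a, W i t a = I * W j t a := by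
    intro i j h0 t
    have hD : ∀ t a, HasDerivAt (fun x => W i x a - I * W j x a)
        (-∑ b, ζ t a b * (W i t b - I * W j t b)) t := by
      intro t a
      refine ((hdW i t a).sub ((hdW j t a).const_mul I)).congr_deriv ?_
      simp only [Fin.sum_univ_three]
      ring
    have h := star_dotProduct_const (u := fun x a => W i x a - I * W j x a) hskew hD hD t
    simp only [h0, sub_self, mul_zero, Finset.sum_const_zero, ← Complex.normSq_eq_conj_mul_self]
      at h
    norm_cast at h
    rw [Finset.sum_eq_zero_iff_of_nonneg fun a _ => Complex.normSq_nonneg _] at h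
    intro a
    exact sub_eq_zero.mp (Complex.normSq_eq_zero.mp (h a (Finset.mem_univ a)))
  have hW0 : ∀ j, W j 0 = complexVec fun i => (1 : Matrix (Fin 6) (Fin 6) ℝ) i j := by
    intro j; simp only [hW, hU0]
  have h1 := hJ 1 0 (by simp only [hW0]; ext a; fin_cases a <;> simp [complexVec]) 1
  have h3 := hJ 3 2 (by simp only [hW0]; ext a; fin_cases a <;> simp [complexVec]) 1
  have h5 := hJ 5 4 (by simp only [hW0]; ext a; fin_cases a <;> simp [complexVec]) 1
  -- The even columns of `U`, read in `ℂ³`, determine `U`: each odd column is `I` times the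
  -- preceding one.
  set Z : ℝ → Matrix (Fin 3) (Fin 3) ℂ := fun t => Matrix.of fun a b => W (![0, 2, 4] b) t a with hZ
  have hZ0 : Z 0 = 1 := by
    ext a b
    fin_cases a <;> fin_cases b <;> simp [hZ, hW0, complexVec]
  refine ⟨Z 1, ?_, ?_⟩
  · rw [Set.mem_ofPred_eq, Matrix.mem_specialUnitaryGroup_iff, Matrix.mem_unitaryGroup_iff']
    constructor
    · ext a b
      -- The entries of `Z* Z` are Hermitian products of solutions, so they keep their value at time
      -- 0.
      have h := star_dotProduct_const hskew (hdW (![0, 2, 4] a)) (hdW (![0, 2, 4] b)) 1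
      have h' : (star (Z 0) * Z 0) a b = (1 : Matrix (Fin 3) (Fin 3) ℂ) a b := by
        rw [hZ0, star_one, one_mul]
      rw [← h']
      exact h
    · rw [det_const (Z := Z) (fun t => complexEntry_trace σ (v t))
        (fun t a b => hdW (![0, 2, 4] b) t a), hZ0, Matrix.det_one]
  · ext i j
    have hre := fun j' j (h : ∀ a, W j' 1 a = I * W j 1 a) a => congrArg Complex.re (h a)
    have him := fun j' j (h : ∀ a, W j' 1 a = I * W j 1 a) a => congrArg Complex.im (h a)
    have r1 := hre 1 0 h1
    have r3 := hre 3 2 h3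
    have r5 := hre 5 4 h5
    have i1 := him 1 0 h1
    have i3 := him 3 2 h3
    have i5 := him 5 4 h5
    simp only [Fin.forall_fin_succ, hW, complexVec] at r1 r3 r5 i1 i3 i5
    simp at r1 r3 r5 i1 i3 i5
    fin_cases i <;> fin_cases j <;>
      simp [realify, splitIndex, hZ, hW, complexVec, r1, r3, r5, i1, i3, i5]

end Holonomy

/-! ### Forms in coordinates, Pontryagin forms and torsion -/

section Coordinates

variable {𝔤 : Type*} [LieRing 𝔤] [LieAlgebra ℝ 𝔤]

/-- The 3-form `eⁱ ∧ eʲ ∧ eᵏ`. -/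
noncomputable def triple (e : Module.Basis (Fin 6) ℝ 𝔤) (i j k : Fin 6) : 𝔤 → 𝔤 → 𝔤 → ℝ :=
  fun X Y Z => e.coord i X * (e.coord j Y * e.coord k Z - e.coord k Y * e.coord j Z)
    - e.coord j X * (e.coord i Y * e.coord k Z - e.coord k Y * e.coord i Z)
    + e.coord k X * (e.coord i Y * e.coord j Z - e.coord j Y * e.coord i Z)

/-- The 4-form `eⁱ ∧ eʲ ∧ eᵏ ∧ eˡ`. -/
noncomputable def quad (e : Module.Basis (Fin 6) ℝ 𝔤) (i j k l : Fin 6) : 𝔤 → 𝔤 → 𝔤 → 𝔤 → ℝ :=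
  wedge22 (wedge (e.coord i) (e.coord j)) (wedge (e.coord k) (e.coord l))

theorem sum_pairs {M : Type*} [AddCommMonoid M] (f : Fin 6 → Fin 6 → M) :
    ∑ i, ∑ j ∈ Finset.Ioi i, f i j =
      f 0 1 + f 0 2 + f 0 3 + f 0 4 + f 0 5 + f 1 2 + f 1 3 + f 1 4 + f 1 5 + f 2 3 + f 2 4 + f 2 5
        + f 3 4 + f 3 5 + f 4 5 := by
  have h0 : Finset.Ioi (0 : Fin 6) = {1, 2, 3, 4, 5} := by decide
  have h1 : Finset.Ioi (1 : Fin 6) = {2, 3, 4, 5} := by decide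
  have h2 : Finset.Ioi (2 : Fin 6) = {3, 4, 5} := by decide
  have h3 : Finset.Ioi (3 : Fin 6) = {4, 5} := by decide
  have h4 : Finset.Ioi (4 : Fin 6) = {5} := by decide
  have h5 : Finset.Ioi (5 : Fin 6) = ∅ := by decide
  simp [Fin.sum_univ_six, h0, h1, h2, h3, h4, h5, add_assoc]

theorem wedge22_neg_neg {V : Type*} (α : V → V → ℝ) :
    wedge22 (-α) (-α) = wedge22 α α := by
  funext X Y Z W
  simp only [wedge22, Pi.neg_apply]
  ring

/-- The 2-form `∑_{i<j} a i j eⁱ ∧ eʲ`. -/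
noncomputable def twoForm (e : Module.Basis (Fin 6) ℝ 𝔤) (a : Matrix (Fin 6) (Fin 6) ℝ) :
    𝔤 → 𝔤 → ℝ := fun X Y => ∑ i, ∑ j ∈ Finset.Ioi i, a i j * wedge (e.coord i) (e.coord j) X Y

/-- The coefficient of `eⁱ ∧ eʲ ∧ eᵏ ∧ eˡ` in `½ Ω ∧ Ω`, for `Ω = ∑ a i j eⁱ ∧ eʲ`. -/
def pfaffian (a : Matrix (Fin 6) (Fin 6) ℝ) (i j k l : Fin 6) : ℝ :=
  a i j * a k l - a i k * a j l + a i l * a j k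

/-- Reduces `Ω ∧ Ω` to arithmetic on a coefficient table. Only entries above the diagonal are read,
so the tables may be upper triangular. -/
theorem wedge22_twoForm_self (e : Module.Basis (Fin 6) ℝ 𝔤) (a : Matrix (Fin 6) (Fin 6) ℝ) :
    wedge22 (twoForm e a) (twoForm e a) = (2 : ℝ) •
      (pfaffian a 0 1 2 3 • quad e 0 1 2 3 + pfaffian a 0 1 2 4 • quad e 0 1 2 4
      + pfaffian a 0 1 2 5 • quad e 0 1 2 5 + pfaffian a 0 1 3 4 • quad e 0 1 3 4
      + pfaffian a 0 1 3 5 • quad e 0 1 3 5 + pfaffian a 0 1 4 5 • quad e 0 1 4 5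
      + pfaffian a 0 2 3 4 • quad e 0 2 3 4 + pfaffian a 0 2 3 5 • quad e 0 2 3 5
      + pfaffian a 0 2 4 5 • quad e 0 2 4 5 + pfaffian a 0 3 4 5 • quad e 0 3 4 5
      + pfaffian a 1 2 3 4 • quad e 1 2 3 4 + pfaffian a 1 2 3 5 • quad e 1 2 3 5
      + pfaffian a 1 2 4 5 • quad e 1 2 4 5 + pfaffian a 1 3 4 5 • quad e 1 3 4 5
      + pfaffian a 2 3 4 5 • quad e 2 3 4 5) := by
  funext X Y Z V
  simp only [twoForm, sum_pairs, Pi.add_apply, Pi.smul_apply, smul_eq_mul, wedge22, quad, wedge,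
    pfaffian]
  ring

theorem constr_apply (e : Module.Basis (Fin 6) ℝ 𝔤) (f : Fin 6 → ℝ) (X : 𝔤) :
    e.constr ℝ f X = ∑ k, e.coord k X * f k := by
  simp [Module.Basis.constr_apply_fintype]

namespace IsU3Valued

variable {σ : Conn 𝔤}

/-- `𝔲(3)` is a Lie subalgebra, so the curvature obeys the same symmetries as the connection; nine
of the fifteen components then suffice for `p1`. -/
theorem curvature_symm (hσ : IsU3Valued σ) :
    curvature σ 1 3 = curvature σ 0 2 ∧ curvature σ 1 2 = -curvature σ 0 3 ∧
    curvature σ 1 5 = curvature σ 0 4 ∧ curvature σ 1 4 = -curvature σ 0 5 ∧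
    curvature σ 3 5 = curvature σ 2 4 ∧ curvature σ 3 4 = -curvature σ 2 5 := by
  have hd := hσ.diag
  refine ⟨?_, ?_, ?_, ?_, ?_, ?_⟩ <;> funext X Y <;>
    simp only [curvature, d1, Pi.add_apply, Pi.neg_apply, Fin.sum_univ_six, wedge,
      hd, hσ.skew 0 1, hσ.skew 0 2, hσ.skew 0 3, hσ.skew 1 2, hσ.skew 1 3, hσ.skew 2 3,
      hσ.skew 2 4, hσ.skew 2 5, hσ.skew 3 4, hσ.skew 3 5, hσ.skew 4 5, hσ.re01, hσ.im01, hσ.re02,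
      hσ.im02, hσ.re12, hσ.im12] <;>
    ring

theorem p1_eq (hσ : IsU3Valued σ) : p1 σ = (1 / (8 * Real.pi ^ 2)) •
    (wedge22 (curvature σ 0 1) (curvature σ 0 1) + wedge22 (curvature σ 2 3) (curvature σ 2 3)
      + wedge22 (curvature σ 4 5) (curvature σ 4 5)
      + (2 : ℝ) • (wedge22 (curvature σ 0 2) (curvature σ 0 2)
        + wedge22 (curvature σ 0 3) (curvature σ 0 3) + wedge22 (curvature σ 0 4) (curvature σ 0 4)
        + wedge22 (curvature σ 0 5) (curvature σ 0 5) + wedge22 (curvature σ 2 4) (curvature σ 2 4)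
        + wedge22 (curvature σ 2 5) (curvature σ 2 5))) := by
  obtain ⟨h13, h12, h15, h14, h35, h34⟩ := hσ.curvature_symm
  rw [p1, sum_pairs, h13, h12, h15, h14, h35, h34, wedge22_neg_neg, wedge22_neg_neg,
    wedge22_neg_neg]
  congr 1
  module

end IsU3Valued

/-- The coframe dual to `e` is adapted to `J`, and its structure equations are those of Family II,
with parameters `p, q, b, g`. -/
structure IsFamilyIIAlgebra (J : 𝔤 →ₗ[ℝ] 𝔤) (e : Module.Basis (Fin 6) ℝ 𝔤) (p q b g : ℝ) :
    Prop where
  bracket0 : ∀ X Y : 𝔤, e.coord 0 ⁅X, Y⁆ = 0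
  bracket1 : ∀ X Y : 𝔤, e.coord 1 ⁅X, Y⁆ = 0
  bracket2 : ∀ X Y : 𝔤, e.coord 2 ⁅X, Y⁆ =
    b * p * (q * wedge (e.coord 0) (e.coord 3) X Y + p * wedge (e.coord 0) (e.coord 4) X Y)
    + g * q * (p * wedge (e.coord 0) (e.coord 2) X Y - q * wedge (e.coord 0) (e.coord 5) X Y
      + p * wedge (e.coord 1) (e.coord 3) X Y + q * wedge (e.coord 1) (e.coord 4) X Y)
  bracket3 : ∀ X Y : 𝔤, e.coord 3 ⁅X, Y⁆ =
    b * p * (q * wedge (e.coord 1) (e.coord 3) X Y + p * wedge (e.coord 1) (e.coord 4) X Y)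
  bracket4 : ∀ X Y : 𝔤, e.coord 4 ⁅X, Y⁆ =
    -(b * q * (q * wedge (e.coord 1) (e.coord 3) X Y + p * wedge (e.coord 1) (e.coord 4) X Y))
  bracket5 : ∀ X Y : 𝔤, e.coord 5 ⁅X, Y⁆ =
    b * q * (q * wedge (e.coord 0) (e.coord 3) X Y + p * wedge (e.coord 0) (e.coord 4) X Y)
    + g * p * (p * wedge (e.coord 0) (e.coord 2) X Y - q * wedge (e.coord 0) (e.coord 5) X Y
      + p * wedge (e.coord 1) (e.coord 3) X Y + q * wedge (e.coord 1) (e.coord 4) X Y)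
  complex0 : ∀ X : 𝔤, e.coord 0 (J X) = e.coord 1 X
  complex1 : ∀ X : 𝔤, e.coord 1 (J X) = -e.coord 0 X
  complex2 : ∀ X : 𝔤, e.coord 2 (J X) = e.coord 3 X
  complex3 : ∀ X : 𝔤, e.coord 3 (J X) = -e.coord 2 X
  complex4 : ∀ X : 𝔤, e.coord 4 (J X) = e.coord 5 X
  complex5 : ∀ X : 𝔤, e.coord 5 (J X) = -e.coord 4 X

/-- The 2-form `e¹² + e³⁴ + e⁵⁶`. -/
noncomputable def standardForm (e : Module.Basis (Fin 6) ℝ 𝔤) : 𝔤 → 𝔤 → ℝ :=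
  wedge (e.coord 0) (e.coord 1) + wedge (e.coord 2) (e.coord 3) + wedge (e.coord 4) (e.coord 5)

namespace IsFamilyIIAlgebra

variable {J : 𝔤 →ₗ[ℝ] 𝔤} {e : Module.Basis (Fin 6) ℝ 𝔤} {p q b g : ℝ}

theorem torsion_eq (h : IsFamilyIIAlgebra J e p q b g) : torsion J (standardForm e) =
    (-(b * p * q)) • triple e 0 2 3 + (b * q ^ 2) • triple e 0 2 4
    - (g * (p ^ 2 + q ^ 2)) • triple e 0 2 5 - (b * p ^ 2) • triple e 0 3 5
    + (b * p * q) • triple e 0 4 5 + (g * p * q) • triple e 1 2 3 + (g * q ^ 2) • triple e 1 2 4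
    + (b * (p ^ 2 + q ^ 2)) • triple e 1 2 5 - (g * p ^ 2) • triple e 1 3 5
    - (g * p * q) • triple e 1 4 5 := by
  funext X Y Z
  simp only [torsion, d2, standardForm, Pi.add_apply, Pi.sub_apply, Pi.smul_apply, smul_eq_mul,
    wedge, triple, h.bracket0, h.bracket1, h.bracket2, h.bracket3, h.bracket4, h.bracket5,
    h.complex0, h.complex1, h.complex2, h.complex3, h.complex4, h.complex5]
  ring

/-- The coefficients of `e⁰¹²³` and `e⁰¹⁴⁵` are exchanged by `p ↔ q` and coincide only if `g² = b²`
or `p² = q²`; the anomaly condition will detect this. -/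
theorem d3_torsion (h : IsFamilyIIAlgebra J e p q b g) : d3 (torsion J (standardForm e)) =
    (-2 * (p ^ 2 + q ^ 2)) • ((g ^ 2 * p ^ 2 + b ^ 2 * q ^ 2) • quad e 0 1 2 3
      + ((g ^ 2 + b ^ 2) * p * q) • (quad e 0 1 2 4 + quad e 0 1 3 5)
      + (g ^ 2 * q ^ 2 + b ^ 2 * p ^ 2) • quad e 0 1 4 5) := by
  rw [h.torsion_eq]
  funext X Y Z V
  simp only [d3, triple, Pi.add_apply, Pi.sub_apply, Pi.smul_apply, smul_eq_mul, quad, wedge22,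
    wedge, h.bracket0, h.bracket1, h.bracket2, h.bracket3, h.bracket4, h.bracket5]
  ring

end IsFamilyIIAlgebra

end Coordinates

/-! ### Chern and Bismut connections, Lee form, holomorphic volume form -/

section Connections

variable {𝔤 : Type*} [LieRing 𝔤] [LieAlgebra ℝ 𝔤]

theorem leviCivita_skew (e : Module.Basis (Fin 6) ℝ 𝔤) (i j : Fin 6) (X : 𝔤) :
    leviCivita e j i X = -leviCivita e i j X := by
  simp only [leviCivita, constr_apply, ← Finset.sum_neg_distrib]
  refine Finset.sum_congr rfl fun k _ => ?_
  rw [← lie_skew (e i) (e j), ← lie_skew (e k) (e j), ← lie_skew (e k) (e i)]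
  simp only [map_neg]
  ring

theorem d2_standardForm_skew (e : Module.Basis (Fin 6) ℝ 𝔤) (X Y Z : 𝔤) :
    d2 (standardForm e) X Z Y = -d2 (standardForm e) X Y Z := by
  simp only [d2, ← lie_skew Z Y, standardForm, wedge, Pi.add_apply, map_neg]
  ring

/-- The coefficients of the component `Ω 0 1` of the curvature of the Chern connection. -/
noncomputable def chernCurvature01 (p q b g : ℝ) : Matrix (Fin 6) (Fin 6) ℝ :=
  !![0, 0, 0, 0, 0, 0;
     0, 0, 0, 0, 0, 0;
     0, 0, 0,
      -((g ^ 2 * p ^ 2 * q ^ 2 + b ^ 2 * p ^ 2 * q ^ 2 + b ^ 2 * q ^ 4 + g ^ 2 * p ^ 4) / 2),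
      -(p * q * (g ^ 2 * q ^ 2 + b ^ 2 * p ^ 2 + b ^ 2 * q ^ 2 + g ^ 2 * p ^ 2) / 2),
      b * g * p * q * (q ^ 2 - p ^ 2);
     0, 0, 0, 0, b * g * p * q * (p ^ 2 - q ^ 2),
      -(p * q * (b ^ 2 * p ^ 2 + g ^ 2 * q ^ 2 + g ^ 2 * p ^ 2 + b ^ 2 * q ^ 2) / 2);
     0, 0, 0, 0, 0,
      -((b ^ 2 * p ^ 4 + g ^ 2 * q ^ 4 + g ^ 2 * p ^ 2 * q ^ 2 + b ^ 2 * p ^ 2 * q ^ 2) / 2);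
     0, 0, 0, 0, 0, 0]

/-- The coefficients of the component `Ω 0 2` of the curvature of the Chern connection. -/
noncomputable def chernCurvature02 (p q b g : ℝ) : Matrix (Fin 6) (Fin 6) ℝ :=
  !![0, 0, -(g ^ 2 * p ^ 2 * (p ^ 2 + q ^ 2) / 4),
      b * g * q ^ 2 * (q ^ 2 - 3 * p ^ 2) / 4,
      b * g * p * q * (q ^ 2 - 3 * p ^ 2) / 4,
      g ^ 2 * p * q * (p ^ 2 + q ^ 2) / 4;
     0, 0, b * g * q ^ 2 * (3 * p ^ 2 - q ^ 2) / 4,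
      -(g ^ 2 * p ^ 2 * (q ^ 2 + p ^ 2) / 4),
      -(g ^ 2 * p * q * (q ^ 2 + p ^ 2) / 4),
      b * g * p * q * (q ^ 2 - 3 * p ^ 2) / 4;
     0, 0, 0, 0, 0, 0;
     0, 0, 0, 0, 0, 0;
     0, 0, 0, 0, 0, 0;
     0, 0, 0, 0, 0, 0]

/-- The coefficients of the component `Ω 0 3` of the curvature of the Chern connection. -/
noncomputable def chernCurvature03 (p q b g : ℝ) : Matrix (Fin 6) (Fin 6) ℝ :=
  !![0, 0, b * g * (2 * p ^ 4 - q ^ 4 - 3 * p ^ 2 * q ^ 2) / 4,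
      g ^ 2 * p ^ 2 * (q ^ 2 + p ^ 2) / 4,
      g ^ 2 * p * q * (q ^ 2 + p ^ 2) / 4,
      b * g * p * q * (3 * q ^ 2 - p ^ 2) / 4;
     0, 0, -(g ^ 2 * p ^ 2 * (q ^ 2 + p ^ 2) / 4),
      b * g * (2 * p ^ 4 - q ^ 4 - 3 * p ^ 2 * q ^ 2) / 4,
      b * g * p * q * (p ^ 2 - 3 * q ^ 2) / 4,
      g ^ 2 * p * q * (q ^ 2 + p ^ 2) / 4;
     0, 0, 0, 0, 0, 0;
     0, 0, 0, 0, 0, 0;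
     0, 0, 0, 0, 0, 0;
     0, 0, 0, 0, 0, 0]

/-- The coefficients of the component `Ω 0 4` of the curvature of the Chern connection. -/
noncomputable def chernCurvature04 (p q b g : ℝ) : Matrix (Fin 6) (Fin 6) ℝ :=
  !![0, 0, b * g * p * q * (q ^ 2 - 3 * p ^ 2) / 4,
      g ^ 2 * p * q * (q ^ 2 + p ^ 2) / 4,
      g ^ 2 * q ^ 2 * (q ^ 2 + p ^ 2) / 4,
      b * g * (3 * p ^ 2 * q ^ 2 + p ^ 4 - 2 * q ^ 4) / 4;
     0, 0, -(g ^ 2 * p * q * (q ^ 2 + p ^ 2) / 4),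
      b * g * p * q * (q ^ 2 - 3 * p ^ 2) / 4,
      b * g * (2 * q ^ 4 - p ^ 4 - 3 * p ^ 2 * q ^ 2) / 4,
      g ^ 2 * q ^ 2 * (q ^ 2 + p ^ 2) / 4;
     0, 0, 0, 0, 0, 0;
     0, 0, 0, 0, 0, 0;
     0, 0, 0, 0, 0, 0;
     0, 0, 0, 0, 0, 0]

/-- The coefficients of the component `Ω 0 5` of the curvature of the Chern connection. -/
noncomputable def chernCurvature05 (p q b g : ℝ) : Matrix (Fin 6) (Fin 6) ℝ :=
  !![0, 0, g ^ 2 * p * q * (q ^ 2 + p ^ 2) / 4,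
      b * g * p * q * (3 * q ^ 2 - p ^ 2) / 4,
      b * g * p ^ 2 * (3 * q ^ 2 - p ^ 2) / 4,
      -(g ^ 2 * q ^ 2 * (q ^ 2 + p ^ 2) / 4);
     0, 0, b * g * p * q * (p ^ 2 - 3 * q ^ 2) / 4,
      g ^ 2 * p * q * (p ^ 2 + q ^ 2) / 4,
      g ^ 2 * q ^ 2 * (p ^ 2 + q ^ 2) / 4,
      b * g * p ^ 2 * (3 * q ^ 2 - p ^ 2) / 4;
     0, 0, 0, 0, 0, 0;
     0, 0, 0, 0, 0, 0;
     0, 0, 0, 0, 0, 0;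
     0, 0, 0, 0, 0, 0]

/-- The coefficients of the component `Ω 2 3` of the curvature of the Chern connection. -/
noncomputable def chernCurvature23 (p q b g : ℝ) : Matrix (Fin 6) (Fin 6) ℝ :=
  !![0, g ^ 2 * (q ^ 4 - p ^ 4) / 2,
      0, 0, 0, 0;
     0, 0, 0, 0, 0, 0;
     0, 0, 0, p ^ 2 * q ^ 2 * (g ^ 2 + b ^ 2) / 2,
      p * q * (g ^ 2 * q ^ 2 + b ^ 2 * p ^ 2) / 2,
      b * g * p * q * (p ^ 2 - q ^ 2) / 2;
     0, 0, 0, 0, b * g * p * q * (q ^ 2 - p ^ 2) / 2,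
      p * q * (b ^ 2 * p ^ 2 + g ^ 2 * q ^ 2) / 2;
     0, 0, 0, 0, 0, (b ^ 2 * p ^ 4 + g ^ 2 * q ^ 4) / 2;
     0, 0, 0, 0, 0, 0]

/-- The coefficients of the component `Ω 2 4` of the curvature of the Chern connection. -/
noncomputable def chernCurvature24 (p q b g : ℝ) : Matrix (Fin 6) (Fin 6) ℝ :=
  !![0, -(g ^ 2 * p * q * (q ^ 2 + p ^ 2)),
      0, 0, 0, 0;
     0, 0, 0, 0, 0, 0;
     0, 0, 0, -(p * q * (g ^ 2 * p ^ 2 + b ^ 2 * q ^ 2) / 2),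
      -(p ^ 2 * q ^ 2 * (g ^ 2 + b ^ 2) / 2),
      b * g * (q ^ 4 - p ^ 4) / 4;
     0, 0, 0, 0, b * g * (p ^ 4 - q ^ 4) / 4,
      -(p ^ 2 * q ^ 2 * (b ^ 2 + g ^ 2) / 2);
     0, 0, 0, 0, 0, -(p * q * (b ^ 2 * p ^ 2 + g ^ 2 * q ^ 2) / 2);
     0, 0, 0, 0, 0, 0]

/-- The coefficients of the component `Ω 2 5` of the curvature of the Chern connection. -/
noncomputable def chernCurvature25 (p q b g : ℝ) : Matrix (Fin 6) (Fin 6) ℝ :=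
  !![0, 0, 0, 0, 0, 0;
     0, 0, 0, 0, 0, 0;
     0, 0, 0, b * g * p * q * (p ^ 2 - q ^ 2) / 2,
      b * g * (p ^ 4 - q ^ 4) / 4,
      0;
     0, 0, 0, 0, 0, b * g * (p ^ 4 - q ^ 4) / 4;
     0, 0, 0, 0, 0, b * g * p * q * (p ^ 2 - q ^ 2) / 2;
     0, 0, 0, 0, 0, 0]

/-- The coefficients of the component `Ω 4 5` of the curvature of the Chern connection. -/
noncomputable def chernCurvature45 (p q b g : ℝ) : Matrix (Fin 6) (Fin 6) ℝ :=
  !![0, g ^ 2 * (p ^ 4 - q ^ 4) / 2,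
      0, 0, 0, 0;
     0, 0, 0, 0, 0, 0;
     0, 0, 0, (b ^ 2 * q ^ 4 + g ^ 2 * p ^ 4) / 2,
      p * q * (b ^ 2 * q ^ 2 + g ^ 2 * p ^ 2) / 2,
      b * g * p * q * (p ^ 2 - q ^ 2) / 2;
     0, 0, 0, 0, b * g * p * q * (q ^ 2 - p ^ 2) / 2,
      p * q * (g ^ 2 * p ^ 2 + b ^ 2 * q ^ 2) / 2;
     0, 0, 0, 0, 0, p ^ 2 * q ^ 2 * (g ^ 2 + b ^ 2) / 2;
     0, 0, 0, 0, 0, 0]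

namespace IsFamilyIIAlgebra

variable {J : 𝔤 →ₗ[ℝ] 𝔤} {e : Module.Basis (Fin 6) ℝ 𝔤} {p q b g : ℝ}

theorem chern_apply (h : IsFamilyIIAlgebra J e p q b g) (X : 𝔤) :
    chern J (standardForm e) e 0 1 X = 0 ∧
    chern J (standardForm e) e 0 2 X = 1 / 2 * (b * p * (q * e.coord 3 X + p * e.coord 4 X)
      + g * q * (p * e.coord 2 X - q * e.coord 5 X)) ∧
    chern J (standardForm e) e 0 3 X = 1 / 2 * (b * p * (q * e.coord 2 X - p * e.coord 5 X)
      - g * q * (p * e.coord 3 X + q * e.coord 4 X)) ∧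
    chern J (standardForm e) e 0 4 X = 1 / 2 * (-(b * q * (q * e.coord 2 X - p * e.coord 5 X))
      + g * p * (p * e.coord 3 X + q * e.coord 4 X)) ∧
    chern J (standardForm e) e 0 5 X = 1 / 2 * (b * q * (q * e.coord 3 X + p * e.coord 4 X)
      + g * p * (p * e.coord 2 X - q * e.coord 5 X)) ∧
    chern J (standardForm e) e 2 3 X = g * p * q * e.coord 1 X ∧
    chern J (standardForm e) e 2 4 X = 1 / 2 * g * (q ^ 2 - p ^ 2) * e.coord 1 X ∧
    chern J (standardForm e) e 2 5 X = -(1 / 2 * g * (p ^ 2 + q ^ 2) * e.coord 0 X) ∧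
    chern J (standardForm e) e 4 5 X = -(g * p * q * e.coord 1 X) := by
  refine ⟨?_, ?_, ?_, ?_, ?_, ?_, ?_, ?_, ?_⟩ <;>
  · simp only [chern, leviCivita, LinearMap.add_apply, constr_apply, Fin.sum_univ_six, d2,
      standardForm, Pi.add_apply, wedge, h.bracket0, h.bracket1, h.bracket2, h.bracket3, h.bracket4,
      h.bracket5, h.complex0, h.complex1, h.complex2, h.complex3, h.complex4, h.complex5,
      coord_basis, Fin.reduceEq, if_true, if_false]
    ring

theorem chern_isU3Valued (h : IsFamilyIIAlgebra J e p q b g) :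
    IsU3Valued (chern J (standardForm e) e) := by
  refine ⟨fun i j X => ?_, fun X => ?_, fun X => ?_, fun X => ?_, fun X => ?_, fun X => ?_,
    fun X => ?_⟩
  · simp only [chern, LinearMap.add_apply, leviCivita_skew e i j, constr_apply, neg_add,
      d2_standardForm_skew e _ (e j) (e i), ← Finset.sum_neg_distrib]
    ring_nf
  all_goals
    simp only [chern, leviCivita, LinearMap.add_apply, constr_apply, Fin.sum_univ_six, d2,
      standardForm, Pi.add_apply, wedge, h.bracket0, h.bracket1, h.bracket2, h.bracket3, h.bracket4,
      h.bracket5, h.complex0, h.complex1, h.complex2, h.complex3, h.complex4, h.complex5,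
      coord_basis, Fin.reduceEq, if_true, if_false]
    ring

/-- Skewness is metric compatibility (Levi-Civita plus a 3-form); the complex linearity and trace
relations follow by substituting the explicit torsion. -/
theorem bismut_isSu3Valued (h : IsFamilyIIAlgebra J e p q b g) :
    IsSu3Valued (bismut J (standardForm e) e) := by
  refine ⟨⟨fun i j X => ?_, fun X => ?_, fun X => ?_, fun X => ?_, fun X => ?_, fun X => ?_,
    fun X => ?_⟩, fun X => ?_⟩
  · have hT : ∀ k, torsion J (standardForm e) (e k) (e i) (e j) =
        -torsion J (standardForm e) (e k) (e j) (e i) := fun k => by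
      simp only [torsion, d2_standardForm_skew e _ (J (e j)) (J (e i))]
    simp only [bismut, LinearMap.add_apply, leviCivita_skew e i j, constr_apply, neg_add, hT,
      ← Finset.sum_neg_distrib]
    ring_nf
  all_goals
    simp only [bismut, h.torsion_eq, leviCivita, LinearMap.add_apply, constr_apply,
      Fin.sum_univ_six, triple, Pi.add_apply, Pi.sub_apply, Pi.smul_apply, smul_eq_mul, wedge,
      h.bracket0, h.bracket1, h.bracket2, h.bracket3, h.bracket4, h.bracket5, coord_basis,
      Fin.reduceEq, if_true, if_false]
    ring

set_option maxHeartbeats 1000000 in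
theorem curvature_chern (h : IsFamilyIIAlgebra J e p q b g) :
    curvature (chern J (standardForm e) e) 0 1 = twoForm e (chernCurvature01 p q b g) ∧
    curvature (chern J (standardForm e) e) 0 2 = twoForm e (chernCurvature02 p q b g) ∧
    curvature (chern J (standardForm e) e) 0 3 = twoForm e (chernCurvature03 p q b g) ∧
    curvature (chern J (standardForm e) e) 0 4 = twoForm e (chernCurvature04 p q b g) ∧
    curvature (chern J (standardForm e) e) 0 5 = twoForm e (chernCurvature05 p q b g) ∧
    curvature (chern J (standardForm e) e) 2 3 = twoForm e (chernCurvature23 p q b g) ∧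
    curvature (chern J (standardForm e) e) 2 4 = twoForm e (chernCurvature24 p q b g) ∧
    curvature (chern J (standardForm e) e) 2 5 = twoForm e (chernCurvature25 p q b g) ∧
    curvature (chern J (standardForm e) e) 4 5 = twoForm e (chernCurvature45 p q b g) := by
  have hu := h.chern_isU3Valued
  have hd := hu.diag
  have hc := h.chern_apply
  simp only [forall_and] at hc
  obtain ⟨h01, h02, h03, h04, h05, h23, h24, h25, h45⟩ := hc
  refine ⟨?_, ?_, ?_, ?_, ?_, ?_, ?_, ?_, ?_⟩ <;> funext X Y <;>
  · rw [twoForm, sum_pairs]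
    simp only [curvature, d1, Pi.add_apply, Fin.sum_univ_six, wedge, hd, hu.skew 0 2,
      hu.skew 0 4, hu.skew 1 2, hu.skew 1 3, hu.skew 1 4,
      hu.skew 1 5, hu.skew 2 3, hu.skew 2 4, hu.skew 2 5, hu.skew 3 4, hu.skew 3 5, hu.skew 4 5,
      hu.re01, hu.im01, hu.re02, hu.im02, hu.re12, hu.im12, h01, h02, h03, h04, h05, h23, h24, h25,
      h45, h.bracket0, h.bracket1, h.bracket2, h.bracket3, h.bracket4, h.bracket5,
      chernCurvature01, chernCurvature02, chernCurvature03,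
      chernCurvature04, chernCurvature05, chernCurvature23, chernCurvature24, chernCurvature25,
      chernCurvature45, Matrix.of_apply, Matrix.cons_val]
    ring

/-- All other 4-form coefficients cancel in the sum over the nine components, and `e⁰¹²³`, `e⁰¹⁴⁵`
get equal weight, unlike in `dT`. -/
theorem p1_chern (h : IsFamilyIIAlgebra J e p q b g) :
    p1 (chern J (standardForm e) e) = (-(b ^ 2 * g ^ 2 * (p ^ 2 - q ^ 2) ^ 2 * (p ^ 2 + q ^ 2) /
      (8 * Real.pi ^ 2))) • ((p ^ 2 + q ^ 2) • (quad e 0 1 2 3 + quad e 0 1 4 5)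
        + (2 * p * q) • (quad e 0 1 2 4 + quad e 0 1 3 5)) := by
  obtain ⟨h01, h02, h03, h04, h05, h23, h24, h25, h45⟩ := h.curvature_chern
  rw [h.chern_isU3Valued.p1_eq, h01, h02, h03, h04, h05, h23, h24, h25, h45]
  simp only [wedge22_twoForm_self, pfaffian, chernCurvature01, chernCurvature02, chernCurvature03,
      chernCurvature04, chernCurvature05, chernCurvature23, chernCurvature24, chernCurvature25,
      chernCurvature45, Matrix.of_apply, Matrix.cons_val]
  module

theorem leviCivita_basis (e : Module.Basis (Fin 6) ℝ 𝔤) (i j k : Fin 6) :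
    leviCivita e i j (e k) = -(1 / 2 : ℝ) *
      (e.coord i ⁅e j, e k⁆ - e.coord k ⁅e i, e j⁆ + e.coord j ⁅e k, e i⁆) := by
  rw [leviCivita, Module.Basis.constr_basis]

theorem leeForm_eq_zero (h : IsFamilyIIAlgebra J e p q b g) : leeForm J (standardForm e) e = 0 := by
  funext X
  simp only [leeForm, formJ, codifferential, Pi.smul_apply, standardForm, Pi.add_apply, wedge,
    coord_nabla, leviCivita_basis, Fin.sum_univ_six, smul_eq_mul, h.bracket0, h.bracket1,
    h.bracket2, h.bracket3, h.bracket4, h.bracket5, h.complex0, h.complex1, h.complex2, h.complex3,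
    h.complex4, h.complex5, coord_basis, Fin.reduceEq, if_true, if_false, Pi.zero_apply]
  ring

theorem integrable (h : IsFamilyIIAlgebra J e p q b g) (X Y : 𝔤) :
    ⁅J X, J Y⁆ = J ⁅J X, Y⁆ + J ⁅X, J Y⁆ + ⁅X, Y⁆ := by
  refine e.ext_elem fun i => ?_
  simp only [← Module.Basis.coord_apply]
  fin_cases i <;>
  · simp only [Fin.zero_eta, Fin.mk_one, Fin.reduceFinMk, map_add, h.bracket0, h.bracket1,
      h.bracket2, h.bracket3, h.bracket4, h.bracket5, h.complex0, h.complex1, h.complex2,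
      h.complex3, h.complex4, h.complex5, wedge]
    ring

theorem sq (h : IsFamilyIIAlgebra J e p q b g) (X : 𝔤) : J (J X) = -X := by
  refine e.ext_elem fun i => ?_
  simp only [← Module.Basis.coord_apply]
  fin_cases i <;>
  simp [-Module.Basis.coord_apply, h.complex0, h.complex1, h.complex2, h.complex3, h.complex4,
    h.complex5]

theorem d3_volumeForm (h : IsFamilyIIAlgebra J e p q b g) : d3 (volumeForm e) = 0 := by
  funext X Y Z V
  simp only [d3, volumeForm, wedge111, Matrix.det_fin_three, Matrix.of_apply, Matrix.cons_val,
    complexCoframe, h.bracket0, h.bracket1, h.bracket2, h.bracket3, h.bracket4, h.bracket5, wedge,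
    Pi.zero_apply]
  apply Complex.ext <;> simp [-Module.Basis.coord_apply] <;> ring

theorem isSU3Structure (h : IsFamilyIIAlgebra J e p q b g) :
    IsSU3Structure J (standardForm e) (volumeForm e) e where
  sq := h.sq
  integrable := h.integrable
  adapted_one := by funext X; simp [formJ, -Module.Basis.coord_apply, h.complex0]
  adapted_two := by funext X; simp [formJ, -Module.Basis.coord_apply, h.complex2]
  adapted_three := by funext X; simp [formJ, -Module.Basis.coord_apply, h.complex4]
  fundamental := rfl
  volume := rfl
  holomorphic := h.d3_volumeForm

end IsFamilyIIAlgebra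

end Connections

/-! ### The connection `A` and the anomaly condition -/

section Instanton

variable {𝔤 : Type*} [LieRing 𝔤] [LieAlgebra ℝ 𝔤]

theorem instantonConn_isSu3Valued (e : Module.Basis (Fin 6) ℝ 𝔤) (l m τ : ℝ) :
    IsSu3Valued (instantonConn e l m τ) := by
  have hM : ∀ i j, instantonMatrix j i = -instantonMatrix i j := by
    intro i j
    fin_cases i <;> fin_cases j <;> simp [instantonMatrix]
  refine ⟨⟨fun i j X => ?_, fun X => ?_, fun X => ?_, fun X => ?_, fun X => ?_, fun X => ?_,
    fun X => ?_⟩, fun X => ?_⟩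
  · simp only [instantonConn, LinearMap.smul_apply, smul_eq_mul, hM i j, neg_mul]
  all_goals
    simp only [instantonConn, instantonMatrix, LinearMap.smul_apply, Matrix.of_apply,
      Matrix.cons_val, smul_eq_mul]
    try ring

theorem p1_eq_zero_of_isFlat {σ : Conn 𝔤} (hσ : IsFlat σ) : p1 σ = 0 := by
  have h : wedge22 (0 : 𝔤 → 𝔤 → ℝ) 0 = 0 := by
    funext X Y Z V
    simp [wedge22]
  simp only [p1, hσ _ _, h, Finset.sum_const_zero, smul_zero]

theorem quad_basis_0123 (e : Module.Basis (Fin 6) ℝ 𝔤) :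
    quad e 0 1 2 3 (e 0) (e 1) (e 2) (e 3) = 1 ∧ quad e 0 1 2 4 (e 0) (e 1) (e 2) (e 3) = 0 ∧
    quad e 0 1 3 5 (e 0) (e 1) (e 2) (e 3) = 0 ∧ quad e 0 1 4 5 (e 0) (e 1) (e 2) (e 3) = 0 := by
  simp [-Module.Basis.coord_apply, quad, wedge22, wedge, coord_basis]

theorem quad_basis_0145 (e : Module.Basis (Fin 6) ℝ 𝔤) :
    quad e 0 1 2 3 (e 0) (e 1) (e 4) (e 5) = 0 ∧ quad e 0 1 2 4 (e 0) (e 1) (e 4) (e 5) = 0 ∧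
    quad e 0 1 3 5 (e 0) (e 1) (e 4) (e 5) = 0 ∧ quad e 0 1 4 5 (e 0) (e 1) (e 4) (e 5) = 1 := by
  simp [-Module.Basis.coord_apply, quad, wedge22, wedge, coord_basis]

namespace IsFamilyIIAlgebra

variable {J : 𝔤 →ₗ[ℝ] 𝔤} {e : Module.Basis (Fin 6) ℝ 𝔤} {p q b g : ℝ}

/-- The quadratic terms vanish because all connection forms are multiples of one form; of its three
summands only the `e⁵` one is not closed. -/
theorem curvature_instantonConn (h : IsFamilyIIAlgebra J e p q b g) (l m τ : ℝ) (i j : Fin 6)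
    (X Y : 𝔤) : curvature (instantonConn e l m τ) i j X Y =
      -(instantonMatrix i j * τ * e.coord 5 ⁅X, Y⁆) := by
  simp only [curvature, d1, Pi.add_apply, Finset.sum_apply, wedge, instantonConn,
    LinearMap.smul_apply, LinearMap.add_apply, smul_eq_mul, h.bracket0, h.bracket1]
  have : ∀ k, ∀ x y : ℝ, instantonMatrix i k * x * (instantonMatrix k j * y) -
      instantonMatrix i k * y * (instantonMatrix k j * x) = 0 := fun _ _ _ => by ring
  simp only [this, Finset.sum_const_zero]
  ring

theorem isFlat_instantonConn (h : IsFamilyIIAlgebra J e p q b g) (l m : ℝ) :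
    IsFlat (instantonConn e l m 0) := by
  intro i j
  funext X Y
  simp [h.curvature_instantonConn]

theorem isSU3Instanton_instantonConn_iff (h : IsFamilyIIAlgebra J e p q b g) (hb : b ≠ 0)
    (hq : q ≠ 0) (l m τ : ℝ) :
    IsSU3Instanton J (standardForm e) (volumeForm e) e (instantonConn e l m τ) ↔ τ = 0 := by
  constructor
  · rintro ⟨-, -, hJ⟩
    -- Here `J e₀ = -e₁` and `J e₃ = e₂`: `de⁵` has coefficient `-b q²` on `e⁰³` and none on `e¹²`,
    -- so type (1,1) fails unless `τ = 0`.
    have := hJ 0 1 0 3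
    simp only [h.curvature_instantonConn, h.bracket5, wedge, h.complex0, h.complex1, h.complex2,
      h.complex3, h.complex4, h.complex5, coord_basis, Fin.reduceEq, if_true, if_false,
      instantonMatrix, Matrix.of_apply, Matrix.cons_val] at this
    have h0 : τ * (b * q ^ 2) = 0 := by linear_combination this
    exact (mul_eq_zero.mp h0).resolve_right (mul_ne_zero hb (pow_ne_zero 2 hq))
  · rintro rfl
    refine ⟨(instantonConn_isSu3Valued e l m 0).isSU3Connection e, fun i j => ?_, fun i j k n => ?_⟩
      <;> simp [h.isFlat_instantonConn l m i j]

theorem torsion_ne_zero (h : IsFamilyIIAlgebra J e p q b g) (hb : b ≠ 0) (hp : p ≠ 0) (hq : q ≠ 0) :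
    torsion J (standardForm e) ≠ 0 := by
  intro h0
  have := congrFun (congrFun (congrFun h0 (e 0)) (e 2)) (e 3)
  simp only [h.torsion_eq, triple, Pi.add_apply, Pi.sub_apply, Pi.smul_apply, smul_eq_mul,
    coord_basis, Fin.reduceEq, if_true, if_false, Pi.zero_apply] at this
  have h1 : b * p * q = 0 := by linear_combination -this
  simp_all

/-- If `dT` is proportional to `p₁(∇ᶜ)`, then the two parameters of the structure equations agree
up to sign. -/
theorem sq_eq_sq_of_d3_torsion_eq (h : IsFamilyIIAlgebra J e p q b g) (hp : p ≠ 0)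
    (hpq : p ^ 2 ≠ q ^ 2) {c : ℝ}
    (hc : d3 (torsion J (standardForm e)) = c • p1 (chern J (standardForm e) e)) :
    g ^ 2 = b ^ 2 := by
  rw [h.d3_torsion, h.p1_chern] at hc
  obtain ⟨a1, a2, a3, a4⟩ := quad_basis_0123 e
  obtain ⟨b1, b2, b3, b4⟩ := quad_basis_0145 e
  have e1 := congrFun (congrFun (congrFun (congrFun hc (e 0)) (e 1)) (e 2)) (e 3)
  have e2 := congrFun (congrFun (congrFun (congrFun hc (e 0)) (e 1)) (e 4)) (e 5)
  simp only [Pi.smul_apply, Pi.add_apply, smul_eq_mul, a1, a2, a3, a4] at e1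
  simp only [Pi.smul_apply, Pi.add_apply, smul_eq_mul, b1, b2, b3, b4] at e2
  -- The right-hand sides of `e1` and `e2` agree, so subtracting eliminates `c`.
  have h0 : (p ^ 2 + q ^ 2) * (p ^ 2 - q ^ 2) * (g ^ 2 - b ^ 2) = 0 := by
    linear_combination (e2 - e1) / 2
  have h1 : p ^ 2 + q ^ 2 ≠ 0 := by positivity
  simpa [h1, sub_eq_zero, hpq] using h0

theorem d3_torsion_eq_smul_p1 (h : IsFamilyIIAlgebra J e p q b g) (hb : b ≠ 0)
    (hpq : p ^ 2 ≠ q ^ 2) (hbg : g ^ 2 = b ^ 2) : d3 (torsion J (standardForm e)) =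
      (16 * Real.pi ^ 2 / (b ^ 2 * (p ^ 2 - q ^ 2) ^ 2)) • p1 (chern J (standardForm e) e) := by
  have hD := sub_ne_zero.mpr hpq
  have hπ := Real.pi_ne_zero
  have hc : 16 * Real.pi ^ 2 / (b ^ 2 * (p ^ 2 - q ^ 2) ^ 2) *
      -(b ^ 2 * b ^ 2 * (p ^ 2 - q ^ 2) ^ 2 * (p ^ 2 + q ^ 2) / (8 * Real.pi ^ 2)) =
      -2 * b ^ 2 * (p ^ 2 + q ^ 2) := by
    field_simp
    ring
  rw [h.d3_torsion, h.p1_chern, hbg, smul_smul, hc]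
  module

end IsFamilyIIAlgebra

end Instanton

/-! ### From the complex coframe to the real structure equations -/

section FamilyII

variable {𝔤 : Type*} [LieRing 𝔤] [LieAlgebra ℝ 𝔤] {w : 𝔤 ≃ₗ[ℝ] (Fin 3 → ℂ)} {r p q : ℝ}
  {e : Module.Basis (Fin 6) ℝ 𝔤}

namespace IsFamilyIIBasis

theorem coord_eq (he : IsFamilyIIBasis w r p q e) (hp : p ≠ 0) (hq : q ≠ 0) (X : 𝔤) :
    e.coord 0 X = r * (w X 0).re ∧ e.coord 1 X = r * (w X 0).im ∧
    e.coord 2 X = p * (w X 1).re - (w X 2).im / (2 * p) ∧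
    e.coord 3 X = p * (w X 1).im + (w X 2).re / (2 * p) ∧
    e.coord 4 X = -(q * (w X 1).im) - (w X 2).re / (2 * q) ∧
    e.coord 5 X = q * (w X 1).re - (w X 2).im / (2 * q) := by
  have hpc : (p : ℂ) ≠ 0 := Complex.ofReal_ne_zero.mpr hp
  have hqc : (q : ℂ) ≠ 0 := Complex.ofReal_ne_zero.mpr hq
  have h0 : (e.coord 0 X : ℂ) + I * (e.coord 1 X : ℂ) = r * w X 0 := congrFun he.one X
  have h1 : (e.coord 2 X : ℂ) + I * (e.coord 3 X : ℂ) = p * w X 1 + I * (w X 2 / ↑(2 * p)) := by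
    have := congrFun he.two X
    simp only [complexCoframe, Pi.smul_apply, Pi.add_apply, coform, smul_eq_mul, Matrix.cons_val]
      at this
    rw [this]
    push_cast
    field_simp
  have h2 : (e.coord 4 X : ℂ) + I * (e.coord 5 X : ℂ) = q * (I * w X 1) - w X 2 / ↑(2 * q) := by
    have := congrFun he.three X
    simp only [complexCoframe, Pi.smul_apply, Pi.sub_apply, coform, smul_eq_mul, Matrix.cons_val]
      at this
    rw [this]
    push_cast
    field_simp
  have key : ∀ (x y : ℝ) (z : ℂ), (x : ℂ) + I * y = z → x = z.re ∧ y = z.im := by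
    rintro x y z rfl
    simp
  obtain ⟨r0, i0⟩ := key _ _ _ h0
  obtain ⟨r1, i1⟩ := key _ _ _ h1
  obtain ⟨r2, i2⟩ := key _ _ _ h2
  rw [r0, i0, r1, i1, r2, i2]
  simp only [Complex.add_re, Complex.add_im, Complex.sub_re, Complex.sub_im, Complex.mul_re,
    Complex.mul_im, Complex.ofReal_re, Complex.ofReal_im, Complex.I_re, Complex.I_im,
    Complex.div_ofReal_re, Complex.div_ofReal_im]
  refine ⟨by ring, by ring, by ring, by ring, by ring, by ring⟩

/-- Inverting the coframe gives `ω³` the factor `2p²q² / (p² - q²)`; the terms in `b` come from `dω²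
= 2 ω¹ ∧ Re ω³`, those in `g` from `dω³`, which carries the sign `ε`. -/
theorem isFamilyIIAlgebra (he : IsFamilyIIBasis w r p q e) {ε : ℝ} (hw : StructureEquations ε w)
    (hr : r ≠ 0) (hp : p ≠ 0) (hq : q ≠ 0) (hpq : p ^ 2 ≠ q ^ 2) :
    IsFamilyIIAlgebra (complexStructure w) e p q (4 * p * q / (r * (p ^ 2 - q ^ 2)))
      (ε / (p * q * (r * (p ^ 2 - q ^ 2)))) := by
  have hD := sub_ne_zero.mpr hpq
  have hJ : ∀ X j, w (complexStructure w X) j = -I * w X j := fun X j => by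
    simp [complexStructure]
  have hb0 : ∀ X Y : 𝔤, w ⁅X, Y⁆ 0 = 0 := fun X Y => by
    simpa [d1, coform] using congrFun (congrFun hw.d_one X) Y
  have hb1 : ∀ X Y : 𝔤, w ⁅X, Y⁆ 1 = -((w X 0 * w Y 2 - w Y 0 * w X 2) +
      (w X 0 * (starRingEnd ℂ) (w Y 2) - w Y 0 * (starRingEnd ℂ) (w X 2))) := fun X Y =>
    neg_eq_iff_eq_neg.mp (congrFun (congrFun hw.d_two X) Y)
  have hb2 : ∀ X Y : 𝔤, w ⁅X, Y⁆ 2 = -(ε * I *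
      ((w X 0 * (starRingEnd ℂ) (w Y 1) - w Y 0 * (starRingEnd ℂ) (w X 1)) -
      (w X 1 * (starRingEnd ℂ) (w Y 0) - w Y 1 * (starRingEnd ℂ) (w X 0)))) := fun X Y =>
    neg_eq_iff_eq_neg.mp (congrFun (congrFun hw.d_three X) Y)
  have hc := he.coord_eq hp hq
  simp only [forall_and] at hc
  obtain ⟨c0, c1, c2, c3, c4, c5⟩ := hc
  constructor <;> intros <;>
  · simp only [wedge, c0, c1, c2, c3, c4, c5, hb0, hb1, hb2, hJ, Complex.neg_re, Complex.neg_im,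
      Complex.add_re, Complex.add_im, Complex.sub_re, Complex.sub_im, Complex.mul_re,
      Complex.mul_im, Complex.conj_re, Complex.conj_im, Complex.I_re, Complex.I_im,
      Complex.ofReal_re, Complex.ofReal_im, Complex.zero_re, Complex.zero_im]
    field_simp
    try ring

/-- The coframe diagonalises `F`: the normalisations `1/2p²` and `1/2q²` make each block contribute
half of the mixed terms, and the diagonal ones match by Vieta. -/
theorem familyII_eq (he : IsFamilyIIBasis w r p q e) (hp : p ≠ 0) (hq : q ≠ 0) {s t : ℝ}
    (hs : s ^ 2 = p ^ 2 + q ^ 2) (ht : t ^ 2 = (p ^ 2 + q ^ 2) / (4 * p ^ 2 * q ^ 2)) :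
    familyII w r s t = standardForm e := by
  funext X Y
  have hc := he.coord_eq hp hq
  simp only [forall_and] at hc
  obtain ⟨c0, c1, c2, c3, c4, c5⟩ := hc
  have hs' : (s : ℂ) ^ 2 = ((s ^ 2 : ℝ) : ℂ) := by push_cast; rfl
  have ht' : (t : ℂ) ^ 2 = ((t ^ 2 : ℝ) : ℂ) := by push_cast; rfl
  have hr' : (r : ℂ) ^ 2 = ((r ^ 2 : ℝ) : ℂ) := by push_cast; rfl
  simp only [familyII, twiceFamilyII, standardForm, Pi.add_apply, Pi.sub_apply, Pi.smul_apply,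
    smul_eq_mul, hs', ht', hr', hs, ht, wedge, conjForm, coform, c0, c1, c2, c3, c4, c5,
    Complex.add_re, Complex.add_im, Complex.sub_re, Complex.sub_im, Complex.mul_re, Complex.mul_im,
    Complex.conj_re, Complex.conj_im, Complex.I_re, Complex.I_im, Complex.ofReal_re,
    Complex.ofReal_im]
  field_simp
  ring

end IsFamilyIIBasis

/-- Vieta's formulas for `t² X² - s² t² X + s² / 4`. -/
theorem vieta_familyII {s t p q : ℝ} (hst : 1 < s ^ 2 * t ^ 2) (hpq : p ^ 2 ≠ q ^ 2)
    (hp : t ^ 2 * (p ^ 2) ^ 2 - s ^ 2 * t ^ 2 * p ^ 2 + s ^ 2 / 4 = 0)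
    (hq : t ^ 2 * (q ^ 2) ^ 2 - s ^ 2 * t ^ 2 * q ^ 2 + s ^ 2 / 4 = 0) :
    p ≠ 0 ∧ q ≠ 0 ∧ s ^ 2 = p ^ 2 + q ^ 2 ∧ t ^ 2 * (4 * p ^ 2 * q ^ 2) = s ^ 2 := by
  have hs : s ≠ 0 := by rintro rfl; norm_num at hst
  have ht : t ≠ 0 := by rintro rfl; norm_num at hst
  have hD := sub_ne_zero.mpr hpq
  have h1 : s ^ 2 = p ^ 2 + q ^ 2 := by
    have : t ^ 2 * (p ^ 2 - q ^ 2) * (p ^ 2 + q ^ 2 - s ^ 2) = 0 := by linear_combination hp - hq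
    have h := (mul_eq_zero.mp this).resolve_left (mul_ne_zero (pow_ne_zero 2 ht) hD)
    linarith
  refine ⟨?_, ?_, h1, ?_⟩
  · rintro rfl
    apply hs
    simpa using hp
  · rintro rfl
    apply hs
    simpa using hq
  · linear_combination (4 * t ^ 2 * p ^ 2) * (-h1) - 4 * hp

end FamilyII

end Heterotic

/-! ### The heterotic system on Family II -/

theorem theorem4p4
    {G : Type*} [TopologicalSpace G] [ChartedSpace E6 G] [Group G] [LieGroup 𝓘(ℝ, E6) ∞ G]
    (Γ : Subgroup G) (hN : IsNilmanifold Γ)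
    (ε : ℝ) (hε : ε = 1 ∨ ε = -1)
    (w : GroupLieAlgebra 𝓘(ℝ, E6) G ≃ₗ[ℝ] (Fin 3 → ℂ)) (hw : StructureEquations ε w)
    (J : GroupLieAlgebra 𝓘(ℝ, E6) G →ₗ[ℝ] GroupLieAlgebra 𝓘(ℝ, E6) G)
    (hJ : J = complexStructure w)
    (r s t : ℝ) (hr : r ≠ 0) (hst : 1 < s ^ 2 * t ^ 2)
    (F : GroupLieAlgebra 𝓘(ℝ, E6) G → GroupLieAlgebra 𝓘(ℝ, E6) G → ℝ)
    (hF : F = familyII w r s t)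
    (p q : ℝ) (hpq : p ^ 2 ≠ q ^ 2)
    (hp : t ^ 2 * (p ^ 2) ^ 2 - s ^ 2 * t ^ 2 * p ^ 2 + s ^ 2 / 4 = 0)
    (hq : t ^ 2 * (q ^ 2) ^ 2 - s ^ 2 * t ^ 2 * q ^ 2 + s ^ 2 / 4 = 0)
    (e : Module.Basis (Fin 6) ℝ (GroupLieAlgebra 𝓘(ℝ, E6) G)) (he : IsFamilyIIBasis w r p q e)
    (Ψ : GroupLieAlgebra 𝓘(ℝ, E6) G → GroupLieAlgebra 𝓘(ℝ, E6) G →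
      GroupLieAlgebra 𝓘(ℝ, E6) G → ℂ)
    (hΨ : Ψ = volumeForm e)
    (l m : ℝ) :
    (∀ τ, IsSU3Connection F Ψ e (instantonConn e l m τ)) ∧
    (∀ τ, IsSU3Instanton J F Ψ e (instantonConn e l m τ) ↔ τ = 0) ∧
    IsFlat (instantonConn e l m 0) ∧
    ((∃ α' : ℝ, AnomalyCancellation J F (chern J F e) (instantonConn e l m 0) α') ↔
      s ^ 2 = t ^ 2) ∧
    (s ^ 2 = t ^ 2 →
      d3 (torsion J F) =
        (4 * r ^ 2 * Real.pi ^ 2) • (p1 (chern J F e) - p1 (instantonConn e l m 0)) ∧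
      d3 (torsion J F) = (4 * r ^ 2 * Real.pi ^ 2) • p1 (chern J F e) ∧
      torsion J F ≠ 0 ∧
      ∀ φ₀ : ℝ, IsHeteroticSolution Γ J F Ψ e (instantonConn e l m 0) (fun _ => φ₀) (2 * r ^ 2)) :=
  by
  obtain ⟨hp0, hq0, hs, ht⟩ := vieta_familyII hst hpq hp hq
  have hs0 : s ^ 2 ≠ 0 := fun h => by rw [h] at hst; norm_num at hst
  have hD := sub_ne_zero.mpr hpq
  have hFe : F = standardForm e := hF.trans <| he.familyII_eq hp0 hq0 hs <| by
    rw [eq_div_iff (by positivity), ← hs, ht]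
  have h := he.isFamilyIIAlgebra hw hr hp0 hq0 hpq
  rw [← hJ] at h
  have hε2 : ε ^ 2 = 1 := by rcases hε with rfl | rfl <;> norm_num
  set b := 4 * p * q / (r * (p ^ 2 - q ^ 2)) with hb_def
  set g := ε / (p * q * (r * (p ^ 2 - q ^ 2))) with hg_def
  have hb : b ≠ 0 := by positivity
  -- Squaring removes `ε`: `g² = b²` reads `(4p²q²)² = 1`, and `4p²q²` is positive and equals `s² /
  -- t²`.
  have hgb : g ^ 2 = b ^ 2 ↔ s ^ 2 = t ^ 2 := by
    have h1 : g ^ 2 = b ^ 2 ↔ (4 * p ^ 2 * q ^ 2) ^ 2 = 1 := by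
      rw [hb_def, hg_def, div_pow, hε2]
      field_simp
      constructor <;> intro h <;> linear_combination -h
    have h2 : 0 < 4 * p ^ 2 * q ^ 2 := by positivity
    rw [h1, pow_eq_one_iff_of_nonneg h2.le two_ne_zero]
    constructor
    · intro h3
      rw [← ht, h3, mul_one]
    · intro h3
      rw [← h3] at ht
      exact (mul_eq_left₀ hs0).mp ht
  have hA := h.isFlat_instantonConn l m
  have hA0 := p1_eq_zero_of_isFlat hA
  subst hFe hΨ
  have hdT : s ^ 2 = t ^ 2 → d3 (torsion J (standardForm e)) =
      (4 * r ^ 2 * Real.pi ^ 2) • p1 (chern J (standardForm e) e) := by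
    intro hst'
    have hpq1 : 4 * p ^ 2 * q ^ 2 = 1 := by
      rw [← hst'] at ht
      exact (mul_eq_left₀ hs0).mp ht
    rw [h.d3_torsion_eq_smul_p1 hb hpq (hgb.mpr hst')]
    congr 1
    -- In general `b²(p² - q²)² = 16p²q² / r²`; with `4p²q² = 1` the ratio becomes `4r²π² = 2π²α'`,
    -- whence `α' = 2r²`.
    have hbD : b ^ 2 * (p ^ 2 - q ^ 2) ^ 2 = 4 / r ^ 2 := by
      rw [hb_def]
      field_simp
      linear_combination hpq1
    rw [hbD]
    field_simp
    norm_num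
  have hanomaly : s ^ 2 = t ^ 2 → AnomalyCancellation J (standardForm e)
      (chern J (standardForm e) e) (instantonConn e l m 0) (2 * r ^ 2) := fun hst' =>
    ⟨by positivity, by rw [hA0, sub_zero, hdT hst']; congr 1; ring⟩
  refine ⟨fun τ => (instantonConn_isSu3Valued e l m τ).isSU3Connection e,
    h.isSU3Instanton_instantonConn_iff hb hq0 l m, hA, ⟨?_, fun hst' => ⟨_, hanomaly hst'⟩⟩,
    fun hst' => ⟨by rw [hA0, sub_zero, hdT hst'], hdT hst', h.torsion_ne_zero hb hp0 hq0,
      fun φ₀ => ?_⟩⟩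
  · rintro ⟨α', -, hα⟩
    rw [hA0, sub_zero] at hα
    exact hgb.mp (h.sq_eq_sq_of_d3_torsion_eq hp0 hpq hα)
  · exact
      { nilmanifold := hN
        structureSU3 := h.isSU3Structure
        gravitino := h.bismut_isSu3Valued.holonomy_subset Γ
        dilaton_smooth := contMDiff_const
        dilaton_invariant := fun _ _ _ => rfl
        dilatino := fun x X => by
          rw [h.leeForm_eq_zero, leftDeriv, mfderiv_const]
          exact (mul_zero 2).symm
        gaugino := (h.isSU3Instanton_instantonConn_iff hb hq0 l m 0).mpr rfl
        anomaly := hanomaly hst' }
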